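/- Let $\Omega\subset\mathbb R^d$ ($d\ge1$) be a bounded open domain. Let $D$ be a real Banach space, $(H_t)_{t\in[0,1]}$ real Hilbert spaces, and $i_t:D\to H_t$ bounded linear operators such that (H1) $\|i_t\|\le C$ for a.e. $t$, with $C>0$ independent of $t$; (H2) $i_t(D)$ is dense in $H_t$ for a.e. $t$; (H3) $t\mapsto\langle i_t\varphi,i_t\psi\rangle_{H_t}$ is Lebesgue measurable for all $\varphi,\psi\in D$. A map $t\mapsto f_t\in H_t$ is called strongly measurable if it is the a.e. limit (in the norms of $H_t$) of step maps $t\mapsto\sum_{j=1}^N 1_{A_j}(t)\,i_t\varphi_j$ with $A_j\subset[0,1]$ measurable and $\varphi_j\in D$; $L^2_H$ is the set of strongly measurable $f$ with $\int_0^1\|f_t\|_{H_t}^2\,dt<\infty$. Let $C^{1,1}(\overline\Omega)$ be the space of differentiable functions on $\overline\Omega$ with finite norm $\|\varphi\|_\infty+\|\nabla\varphi\|_\infty+\mathrm{Lip}(\nabla\varphi)$, and let $\mathcal M(\overline\Omega)$ be the space of finite signed Borel measures on $\overline\Omega$, mapped into $C^{1,1}(\overline\Omega)^*$ by integration. Let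 $K_t^*:C^{1,1}(\overline\Omega)^*\to H_t$ be bounded linear operators such that (F1) for a.e. $t$, $K_t^*$ is weak*-to-weak continuous, with pre-adjoint $K_t:H_t\to C^{1,1}(\overline\Omega)$; (F2) $\|K_t^*\|\le C$ for a.e. $t$, with $C>0$ independent of $t$; (F3) $t\mapsto K_t^*\rho$ is strongly measurable for every $\rho\in\mathcal M(\overline\Omega)$; (F4) there is a closed convex set $E\Subset\Omega$ (that is, $E$ is compact and contained in $\Omega$) such that, for a.e. $t$, $\operatorname{supp}(K_th)\subset E$ and $\operatorname{supp}(\nabla(K_th))\subset E$ for all $h\in H_t$. Let $t\in[0,1]\mapsto\tilde\rho_t\in\mathcal M(\overline\Omega)$ be narrowly continuous (i.e. $t\mapsto\int\varphi\,d\tilde\rho_t$ is continuous for all $\varphi\in C(\overline\Omega)$), let $f\in L^2_H$ and $\alpha,\beta>0$. Set $w_t:=-K_t(K_t^*\tilde\rho_t-f_t)$ on $\overline\Omega$ and $w_t:=0$ on $\mathbb R^d\setminus\overline\Omega$ for a.e. $t$. On the Hilbert space $H^1:=H^1([0,1];\mathbb R^d)$, whose elements are identified with their continuous representatives and whose inner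 product is $\int_0^1\gamma\cdot\eta\,dt+\int_0^1\dot\gamma\cdot\dot\eta\,dt$, define $$F(\gamma):=\frac{-\int_0^1 w_t(\gamma(t))\,dt}{\frac\beta2\int_0^1|\dot\gamma(t)|^2\,dt+\alpha}.$$ Then $t\mapsto w_t(\gamma(t))$ is integrable for every $\gamma\in H^1$, and $F:H^1\to\mathbb R$ is continuously Fréchet differentiable. Call $(\gamma^n)_{n\ge0}\subset H^1$ a descent sequence if $F(\gamma^0)<0$ and $\gamma^{n+1}=\gamma^n-\delta_n\nabla F(\gamma^n)$ for all $n\ge 0$, where $\nabla F(\gamma)\in H^1$ is the Riesz representative of the Fréchet derivative $D_\gamma F$, and where the step sizes satisfy one of the following two rules: * (Armijo–Goldstein) there are constants $0<c_1<c_2<1$ such that for all $n$: $\delta_n>0$ and $F(\gamma^n)-c_2\delta_n\|\nabla F(\gamma^n)\|^2\le F(\gamma^{n+1})\le F(\gamma^n)-c_1\delta_n\|\nabla F(\gamma^n)\|^2$; * (Backtracking–Armijo) there are constants $\delta^0>0$ and $\tau,c\in(0,1)$ such that for all $n$: $\delta_n$ is the first $\delta$ among $\delta^0,\tau\delta^0,\tau^2\delta^0,\dots$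 with $F(\gamma^n-\delta\nabla F(\gamma^n))\le F(\gamma^n)-c\,\delta\,\|\nabla F(\gamma^n)\|^2$. Every descent sequence has a subsequence converging strongly in $H^1$, and the limit $\gamma^*$ of any strongly convergent subsequence satisfies $F(\gamma^*)<0$, $D_{\gamma^*}F=0$ and $\gamma^*([0,1])\subset E$. -/

import Mathlib

open MeasureTheory Filter Topology Asymptotics
open scoped unitInterval BoundedContinuousFunction RealInnerProductSpace NNReal ENNReal

noncomputable section

namespace DynamicInverse

/-! ### The space `C^{1,1}(S)` -/

section C11

variable {d : ℕ}

/-- Pairs `(φ, ∇φ)` on `S` where `φ` is bounded and differentiable on `S` with bounded, globally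
Lipschitz gradient `∇φ`. -/
def c11Submodule (S : Set (EuclideanSpace ℝ (Fin d))) :
    Submodule ℝ ((S →ᵇ ℝ) × (S →ᵇ EuclideanSpace ℝ (Fin d))) where
  carrier := {p |
    (∀ x : S, (fun y : S => p.1 y - p.1 x -
        ⟪p.2 x, (y : EuclideanSpace ℝ (Fin d)) - (x : EuclideanSpace ℝ (Fin d))⟫)
      =o[𝓝 x] fun y : S => (y : EuclideanSpace ℝ (Fin d)) - (x : EuclideanSpace ℝ (Fin d))) ∧
    MemHolder 1 p.2}
  zero_mem' := by
    refine ⟨fun x => ?_, ?_⟩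
    · simp
    · exact memHolder_zero
  add_mem' := by
    rintro p q ⟨hp, hp'⟩ ⟨hq, hq'⟩
    refine ⟨fun x => ?_, hp'.add hq'⟩
    refine ((hp x).add (hq x)).congr_left fun y => ?_
    simp [inner_add_left]; ring
  smul_mem' := by
    rintro c p ⟨hp, hp'⟩
    refine ⟨fun x => ?_, hp'.smul (c := c)⟩
    refine ((hp x).const_mul_left c).congr_left fun y => ?_
    simp [real_inner_smul_left]; ring

/-- The space `C^{1,1}(S)`. An element is stored together with its gradient; if `S` is the closure
of an open set, the gradient is determined by the function (see `C11.ext_of_isOpen`). -/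
def C11 (S : Set (EuclideanSpace ℝ (Fin d))) : Type := c11Submodule S

variable {S : Set (EuclideanSpace ℝ (Fin d))}

instance : AddCommGroup (C11 S) := inferInstanceAs (AddCommGroup (c11Submodule S))
instance : Module ℝ (C11 S) := inferInstanceAs (Module ℝ (c11Submodule S))

/-- The underlying function of an element of `C^{1,1}(S)`. -/
def C11.toBCF (φ : C11 S) : S →ᵇ ℝ := φ.1.1

/-- The gradient of an element of `C^{1,1}(S)`. -/
def C11.grad (φ : C11 S) : S →ᵇ EuclideanSpace ℝ (Fin d) := φ.1.2

@[ext] theorem C11.ext {φ ψ : C11 S} (h : φ.toBCF = ψ.toBCF) (h' : φ.grad = ψ.grad) : φ = ψ :=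
  Subtype.ext (Prod.ext h h')

theorem C11.memHolder (φ : C11 S) : MemHolder 1 φ.grad := φ.2.2

@[simp] theorem C11.toBCF_add (φ ψ : C11 S) : (φ + ψ).toBCF = φ.toBCF + ψ.toBCF := rfl
@[simp] theorem C11.grad_add (φ ψ : C11 S) : (φ + ψ).grad = φ.grad + ψ.grad := rfl
@[simp] theorem C11.toBCF_smul (c : ℝ) (φ : C11 S) : (c • φ).toBCF = c • φ.toBCF := rfl
@[simp] theorem C11.grad_smul (c : ℝ) (φ : C11 S) : (c • φ).grad = c • φ.grad := rfl

/-- `‖φ‖ = ‖φ‖_∞ + ‖∇φ‖_∞ + Lip(∇φ)`. -/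
instance : Norm (C11 S) :=
  ⟨fun φ => ‖φ.toBCF‖ + ‖φ.grad‖ + (nnHolderNorm 1 φ.grad : ℝ)⟩

theorem C11.norm_def (φ : C11 S) :
    ‖φ‖ = ‖φ.toBCF‖ + ‖φ.grad‖ + (nnHolderNorm 1 φ.grad : ℝ) := rfl

theorem C11.normedSpaceCore : NormedSpace.Core ℝ (C11 S) where
  norm_nonneg φ := by rw [C11.norm_def]; positivity
  norm_smul c φ := by
    have h := MemHolder.nnHolderNorm_smul φ.memHolder c
    have h2 : nnHolderNorm 1 (c • φ).grad = ‖c‖₊ * nnHolderNorm 1 φ.grad := h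
    rw [C11.norm_def, C11.norm_def, h2, C11.toBCF_smul, C11.grad_smul, norm_smul, norm_smul]
    push_cast
    ring
  norm_triangle φ ψ := by
    have h := MemHolder.nnHolderNorm_add_le φ.memHolder ψ.memHolder
    have h2 : (nnHolderNorm 1 (φ + ψ).grad : ℝ) ≤ nnHolderNorm 1 φ.grad + nnHolderNorm 1 ψ.grad := by
      exact_mod_cast h
    have h3 := norm_add_le φ.toBCF ψ.toBCF
    have h4 := norm_add_le φ.grad ψ.grad
    rw [C11.norm_def, C11.norm_def, C11.norm_def, C11.toBCF_add]
    rw [← C11.grad_add] at h4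
    linarith
  norm_eq_zero_iff φ := by
    constructor
    · intro h
      rw [C11.norm_def] at h
      have h1 := norm_nonneg φ.toBCF
      have h2 := norm_nonneg φ.grad
      have h3 : (0 : ℝ) ≤ nnHolderNorm 1 φ.grad := by positivity
      have h4 : ‖φ.toBCF‖ = 0 := by linarith
      have h5 : ‖φ.grad‖ = 0 := by linarith
      exact C11.ext (norm_eq_zero.1 h4) (norm_eq_zero.1 h5)
    · rintro rfl
      have h1 : (0 : C11 S).toBCF = 0 := rfl
      have h2 : (0 : C11 S).grad = 0 := rfl
      have h3 : nnHolderNorm 1 (0 : C11 S).grad = 0 := nnHolderNorm_zero (X := S) 1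
      rw [C11.norm_def, h3, h1, h2]
      simp

instance : NormedAddCommGroup (C11 S) := NormedAddCommGroup.ofCore C11.normedSpaceCore
instance : NormedSpace ℝ (C11 S) := NormedSpace.ofCore C11.normedSpaceCore

/-- On the closure of an open set an element of `C^{1,1}` is determined by its values. -/
theorem C11.ext_of_isOpen {Ω : Set (EuclideanSpace ℝ (Fin d))} (hΩ : IsOpen Ω)
    {φ ψ : C11 (closure Ω)} (h : ∀ x, φ.toBCF x = ψ.toBCF x) : φ = ψ := by
  have hb : φ.toBCF = ψ.toBCF := BoundedContinuousFunction.ext h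
  refine C11.ext hb (BoundedContinuousFunction.ext fun x => ?_)
  have hcont : Set.EqOn φ.grad ψ.grad {x : closure Ω | (x : EuclideanSpace ℝ (Fin d)) ∈ Ω} := by
    intro x hx
    have hx : (x : EuclideanSpace ℝ (Fin d)) ∈ Ω := hx
    have h1 : (fun y : closure Ω => ⟪φ.grad x - ψ.grad x,
          (y : EuclideanSpace ℝ (Fin d)) - (x : EuclideanSpace ℝ (Fin d))⟫)
        =o[𝓝 x] fun y : closure Ω =>
          (y : EuclideanSpace ℝ (Fin d)) - (x : EuclideanSpace ℝ (Fin d)) := by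
      refine ((ψ.2.1 x).sub (φ.2.1 x)).congr_left fun y => ?_
      change (ψ.toBCF y - ψ.toBCF x - ⟪ψ.grad x, _⟫) - (φ.toBCF y - φ.toBCF x - ⟪φ.grad x, _⟫) = _
      rw [hb, inner_sub_left]; ring
    have hnhds : closure Ω ∈ 𝓝 (x : EuclideanSpace ℝ (Fin d)) :=
      mem_of_superset (hΩ.mem_nhds hx) subset_closure
    have h2 : (fun y : EuclideanSpace ℝ (Fin d) => ⟪φ.grad x - ψ.grad x, y - x⟫)
        =o[𝓝 (x : EuclideanSpace ℝ (Fin d))] fun y => y - (x : EuclideanSpace ℝ (Fin d)) := by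
      have := map_nhds_subtype_coe_eq_nhds x.2 hnhds
      rw [← this, isLittleO_map]
      exact h1
    have h3 : HasFDerivAt (fun _ : EuclideanSpace ℝ (Fin d) => (0 : ℝ))
        (innerSL ℝ (φ.grad x - ψ.grad x)) (x : EuclideanSpace ℝ (Fin d)) := by
      refine HasFDerivAt.of_isLittleO (h2.neg_left.congr_left fun y => ?_)
      simp [inner_sub_left]
    have h4 := h3.unique (hasFDerivAt_const (0 : ℝ) _)
    have h5 : ⟪φ.grad x - ψ.grad x, φ.grad x - ψ.grad x⟫ = 0 := by
      exact congrArg (fun l => l (φ.grad x - ψ.grad x)) h4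
    exact sub_eq_zero.1 (inner_self_eq_zero.1 h5)
  have hd : Dense {x : closure Ω | (x : EuclideanSpace ℝ (Fin d)) ∈ Ω} := by
    rw [Subtype.dense_iff]
    intro y hy
    refine closure_mono ?_ hy
    intro z hz
    exact ⟨⟨z, subset_closure hz⟩, hz, rfl⟩
  exact congrFun (Continuous.ext_on hd φ.grad.continuous ψ.grad.continuous hcont) x

end C11

/-! ### Signed measures on `S` as functionals on `C^{1,1}(S)` -/

section Measures

variable {d : ℕ} {S : Set (EuclideanSpace ℝ (Fin d))}

theorem isFiniteMeasure_variation (ρ : SignedMeasure S) : IsFiniteMeasure ρ.variation := by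
  rw [← ρ.totalVariation_eq_variation]
  unfold SignedMeasure.totalVariation
  infer_instance

theorem integrable_bcf (ρ : SignedMeasure S) (φ : S →ᵇ ℝ) :
    MeasureTheory.Integrable φ ρ.variation := by
  have := isFiniteMeasure_variation ρ
  exact φ.integrable _

/-- The embedding `𝓜(S) → C^{1,1}(S)^*`, `ρ ↦ (φ ↦ ∫ φ dρ)`. -/
def measureToDual (ρ : SignedMeasure S) : StrongDual ℝ (C11 S) :=
  LinearMap.mkContinuous
    { toFun := fun φ => ∫ᵛ x, φ.toBCF x ∂•ρ
      map_add' := fun φ ψ => VectorMeasure.integral_fun_add (integrable_bcf ρ φ.toBCF)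
        (integrable_bcf ρ ψ.toBCF)
      map_smul' := fun c φ => VectorMeasure.integral_fun_smul ρ _ c φ.toBCF }
    (ρ.variation.real Set.univ) fun φ => by
      have := isFiniteMeasure_variation ρ
      have h1 : ‖∫ᵛ x, φ.toBCF x ∂•ρ‖ ≤ 1 * ∫ x, ‖φ.toBCF x‖ ∂ρ.variation :=
        VectorMeasure.norm_integral_le_integral_norm.trans
          (mul_le_mul_of_nonneg_right (by simp) (by positivity))
      have h2 : ∫ x, ‖φ.toBCF x‖ ∂ρ.variation ≤ ∫ _, ‖φ‖ ∂ρ.variation := by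
        refine integral_mono (integrable_bcf ρ φ.toBCF).norm (integrable_const _) fun x => ?_
        refine (φ.toBCF.norm_coe_le_norm x).trans ?_
        rw [C11.norm_def]
        have := norm_nonneg φ.grad
        have : (0 : ℝ) ≤ nnHolderNorm 1 φ.grad := by positivity
        linarith
      rw [integral_const, smul_eq_mul] at h2
      exact h1.trans (by linarith)

theorem measureToDual_apply (ρ : SignedMeasure S) (φ : C11 S) :
    measureToDual ρ φ = ∫ᵛ x, φ.toBCF x ∂•ρ := rfl

/-- Narrowly continuous curves `t ↦ ρ_t ∈ 𝓜(S)`, `t ∈ [0,1]`. -/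
def NarrowlyContinuous (ρ : I → SignedMeasure S) : Prop :=
  ∀ φ : C(S, ℝ), Continuous fun t => ∫ᵛ x, φ x ∂•(ρ t)

end Measures

/-! ### Weak*-to-weak continuous operators and their pre-adjoints -/

section PreAdjoint

variable {X : Type*} [NormedAddCommGroup X] [NormedSpace ℝ X]
  {Y : Type*} [NormedAddCommGroup Y] [InnerProductSpace ℝ Y]

/-- Weak*-to-weak continuity of `T : X^* → Y`. -/
def WeakStarToWeakContinuous (T : StrongDual ℝ X →L[ℝ] Y) : Prop :=
  Continuous fun ξ : WeakDual ℝ X => toWeakSpace ℝ Y (T (WeakDual.toStrongDual ξ))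

open Classical in
/-- The pre-adjoint `Y → X` of a weak*-to-weak continuous operator `T : X^* → Y`, characterised by
`ξ (preAdjoint T y) = ⟪T ξ, y⟫` (see `preAdjoint_spec`). -/
def preAdjoint (T : StrongDual ℝ X →L[ℝ] Y) (y : Y) : X :=
  if h : ∃ x : X, ∀ ξ : StrongDual ℝ X, ξ x = ⟪T ξ, y⟫ then h.choose else 0

theorem preAdjoint_spec {T : StrongDual ℝ X →L[ℝ] Y} (hT : WeakStarToWeakContinuous T) (y : Y)
    (ξ : StrongDual ℝ X) : ξ (preAdjoint T y) = ⟪T ξ, y⟫ := by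
  have hex : ∃ x : X, ∀ ξ : StrongDual ℝ X, ξ x = ⟪T ξ, y⟫ := by
    let g : WeakDual ℝ X →L[ℝ] ℝ :=
      { toFun := fun ξ => ⟪T (WeakDual.toStrongDual ξ), y⟫
        map_add' := fun a b => by simp [inner_add_left]
        map_smul' := fun c a => by simp [real_inner_smul_left]
        cont := by
          have h1 := (WeakBilin.eval_continuous (topDualPairing ℝ Y).flip (innerSL ℝ y)).comp hT
          refine h1.congr fun ξ => ?_
          exact real_inner_comm _ _ }
    obtain ⟨x, hx⟩ := LinearMap.dualEmbedding_surjective (topDualPairing ℝ X) g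
    exact ⟨x, fun ξ => congrArg (fun l => l (StrongDual.toWeakDual ξ)) hx⟩
  rw [preAdjoint, dif_pos hex]
  exact hex.choose_spec ξ

end PreAdjoint

/-! ### Time-dependent Hilbert spaces -/

section TimeDependent

variable {D : Type*} [NormedAddCommGroup D] [NormedSpace ℝ D]
  {H : I → Type*} [∀ t, NormedAddCommGroup (H t)] [∀ t, InnerProductSpace ℝ (H t)]

/-- Assumptions on the sampling operators `i_t : D → H_t`: uniformly bounded, with dense range, and
`t ↦ ⟪i_t φ, i_t ψ⟫` Lebesgue measurable for all `φ, ψ ∈ D`. -/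
structure SamplingAssumptions (i : ∀ t, D →L[ℝ] H t) : Prop where
  bound : ∃ C : ℝ, 0 < C ∧ ∀ᵐ t : I, ‖i t‖ ≤ C
  dense : ∀ᵐ t : I, DenseRange (i t)
  measurable : ∀ φ ψ : D, AEMeasurable (fun t : I => ⟪i t φ, i t ψ⟫)

/-- Step maps `t ↦ ∑ j, 1_{A_j}(t) i_t φ_j ∈ H_t`. -/
def IsStepMap (i : ∀ t, D →L[ℝ] H t) (s : ∀ t, H t) : Prop :=
  ∃ (N : ℕ) (A : Fin N → Set I) (φ : Fin N → D), (∀ j, MeasurableSet (A j)) ∧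
    ∀ t, s t = ∑ j, (A j).indicator (fun _ => i t (φ j)) t

/-- Strong measurability of `t ↦ f_t ∈ H_t`: almost everywhere limit of step maps. -/
def StronglyMeasurableMap (i : ∀ t, D →L[ℝ] H t) (f : ∀ t, H t) : Prop :=
  ∃ s : ℕ → ∀ t, H t, (∀ n, IsStepMap i (s n)) ∧
    ∀ᵐ t : I, Tendsto (fun n => s n t) atTop (𝓝 (f t))

/-- `f ∈ L²_H = L²([0,1]; H)`. -/
def MemL2H (i : ∀ t, D →L[ℝ] H t) (f : ∀ t, H t) : Prop :=
  StronglyMeasurableMap i f ∧ Integrable (fun t : I => ‖f t‖ ^ 2)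

variable {d : ℕ}

/-- Assumptions on the forward operators `K_t^* : C^{1,1}(closure Ω)^* → H_t`: weak*-to-weak
continuity, uniform boundedness, strong measurability of `t ↦ K_t^* ρ` for each `ρ ∈ 𝓜(closure Ω)`,
and supports of `K_t h`, `∇(K_t h)` in the closed convex set `E ⋐ Ω`. -/
structure ForwardAssumptions (Ω E : Set (EuclideanSpace ℝ (Fin d))) (i : ∀ t, D →L[ℝ] H t)
    (Kstar : ∀ t, StrongDual ℝ (C11 (closure Ω)) →L[ℝ] H t) : Prop where
  weak_continuous : ∀ᵐ t : I, WeakStarToWeakContinuous (Kstar t)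
  bound : ∃ C : ℝ, 0 < C ∧ ∀ᵐ t : I, ‖Kstar t‖ ≤ C
  stronglyMeasurable : ∀ ρ : SignedMeasure (closure Ω),
    StronglyMeasurableMap i fun t => Kstar t (measureToDual ρ)
  isClosed : IsClosed E
  convex : Convex ℝ E
  compactly_contained : IsCompact (closure E) ∧ closure E ⊆ Ω
  support_subset : ∀ᵐ t : I, ∀ h : H t,
    Subtype.val '' tsupport (preAdjoint (Kstar t) h).toBCF ⊆ E ∧
    Subtype.val '' tsupport (preAdjoint (Kstar t) h).grad ⊆ E

open Classical in
/-- The dual variable `w_t = -K_t (K_t^* ρ_t - f_t)`, extended by zero outside `closure Ω`. -/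
def dualVariable {Ω : Set (EuclideanSpace ℝ (Fin d))}
    (Kstar : ∀ t, StrongDual ℝ (C11 (closure Ω)) →L[ℝ] H t)
    (ρ : I → SignedMeasure (closure Ω)) (f : ∀ t, H t) (t : I) (x : EuclideanSpace ℝ (Fin d)) : ℝ :=
  if hx : x ∈ closure Ω then
    (-preAdjoint (Kstar t) (Kstar t (measureToDual (ρ t)) - f t)).toBCF ⟨x, hx⟩
  else 0

end TimeDependent

/-! ### The Hilbert space `H¹([0,1]; ℝᵈ)` -/

section H1

variable {d : ℕ}

theorem integrable_lp (v : Lp (EuclideanSpace ℝ (Fin d)) 2 (volume : Measure I)) :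
    Integrable (fun t => v t) :=
  (Lp.memLp v).integrable (by norm_num)

/-- Pairs `(γ, γ')` of a continuous curve `γ` and `γ' ∈ L²` with `γ(t) = γ(0) + ∫₀ᵗ γ'(s) ds`. -/
def h1Submodule (d : ℕ) : Submodule ℝ
    (C(I, EuclideanSpace ℝ (Fin d)) × Lp (EuclideanSpace ℝ (Fin d)) 2 (volume : Measure I)) where
  carrier := {p | ∀ t, p.1 t = p.1 0 + ∫ s in Set.Iic t, p.2 s}
  zero_mem' := by
    intro t
    simp
  add_mem' := by
    intro p q hp hq t
    have h : ∫ s in Set.Iic t, (p.2 + q.2) s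
        = (∫ s in Set.Iic t, p.2 s) + ∫ s in Set.Iic t, q.2 s := by
      rw [integral_congr_ae (ae_restrict_of_ae (Lp.coeFn_add p.2 q.2))]
      exact integral_add (integrable_lp p.2).integrableOn (integrable_lp q.2).integrableOn
    change p.1 t + q.1 t = (p.1 0 + q.1 0) + ∫ s in Set.Iic t, (p.2 + q.2) s
    rw [h, hp t, hq t]
    abel
  smul_mem' := by
    intro c p hp t
    have h : ∫ s in Set.Iic t, (c • p.2) s = c • ∫ s in Set.Iic t, p.2 s := by
      rw [integral_congr_ae (ae_restrict_of_ae (Lp.coeFn_smul c p.2))]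
      exact integral_smul c _
    change c • p.1 t = c • p.1 0 + ∫ s in Set.Iic t, (c • p.2) s
    rw [h, hp t, smul_add]

/-- `H¹([0,1]; ℝᵈ)`: absolutely continuous curves with derivative in `L²`, each identified with its
continuous representative. -/
def H1 (d : ℕ) : Type := h1Submodule d

instance : AddCommGroup (H1 d) := inferInstanceAs (AddCommGroup (h1Submodule d))
instance : Module ℝ (H1 d) := inferInstanceAs (Module ℝ (h1Submodule d))

/-- The continuous curve underlying an element of `H¹`. -/
def H1.curve (γ : H1 d) : C(I, EuclideanSpace ℝ (Fin d)) := γ.1.1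

/-- The weak derivative of an element of `H¹`. -/
def H1.deriv (γ : H1 d) : Lp (EuclideanSpace ℝ (Fin d)) 2 (volume : Measure I) := γ.1.2

theorem H1.curve_eq (γ : H1 d) (t : I) : γ.curve t = γ.curve 0 + ∫ s in Set.Iic t, γ.deriv s :=
  γ.2 t

theorem integral_norm_lp_le (v : Lp (EuclideanSpace ℝ (Fin d)) 2 (volume : Measure I)) :
    ∫ t, ‖v t‖ ≤ ‖v‖ := by
  have h1 : eLpNorm v 1 volume ≤ eLpNorm v 2 volume :=
    eLpNorm_le_eLpNorm_of_exponent_le (by norm_num) (Lp.aestronglyMeasurable v)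
  rw [Lp.norm_def, integral_norm_eq_lintegral_enorm (Lp.aestronglyMeasurable v),
    ← eLpNorm_one_eq_lintegral_enorm]
  exact ENNReal.toReal_mono (Lp.eLpNorm_ne_top v) h1

theorem H1.norm_curve_sub_le (γ : H1 d) (s t : I) : ‖γ.curve t - γ.curve s‖ ≤ ‖γ.deriv‖ := by
  have hv := integrable_lp γ.deriv
  rw [γ.curve_eq t, γ.curve_eq s, add_sub_add_left_eq_sub,
    ← integral_indicator measurableSet_Iic, ← integral_indicator measurableSet_Iic,
    ← integral_sub (hv.indicator measurableSet_Iic) (hv.indicator measurableSet_Iic)]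
  refine (norm_integral_le_of_norm_le hv.norm (ae_of_all _ fun r => ?_)).trans
    (integral_norm_lp_le γ.deriv)
  by_cases h1 : r ∈ Set.Iic t <;> by_cases h2 : r ∈ Set.Iic s <;> simp [h1, h2]

theorem continuous_integrable {f : I → ℝ} (hf : Continuous f) : Integrable f :=
  hf.integrable_of_hasCompactSupport (HasCompactSupport.of_compactSpace f)

theorem H1.norm_curve_le (γ : H1 d) (t : I) :
    ‖γ.curve t‖ ≤ √(∫ s, ‖γ.curve s‖ ^ 2) + ‖γ.deriv‖ := by
  obtain ⟨s, hs⟩ := exists_le_integral (μ := (volume : Measure I))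
    (continuous_integrable (f := fun s => ‖γ.curve s‖ ^ 2) (by fun_prop))
  have h1 : ‖γ.curve s‖ ≤ √(∫ s, ‖γ.curve s‖ ^ 2) := Real.le_sqrt_of_sq_le hs
  have h2 := γ.norm_curve_sub_le s t
  have h3 := norm_le_norm_add_norm_sub' (γ.curve t) (γ.curve s)
  linarith

/-- `⟪γ, η⟫ = ∫₀¹ γ · η dt + ∫₀¹ γ' · η' dt`. -/
abbrev H1.core (d : ℕ) : InnerProductSpace.Core ℝ (H1 d) where
  inner γ η := (∫ t, ⟪γ.curve t, η.curve t⟫) + ∫ t, ⟪γ.deriv t, η.deriv t⟫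
  conj_inner_symm γ η := by simp [real_inner_comm]
  re_inner_nonneg γ := by
    have h1 : 0 ≤ ∫ t, ⟪γ.curve t, γ.curve t⟫ := integral_nonneg fun t => real_inner_self_nonneg
    have h2 : 0 ≤ ∫ t, ⟪γ.deriv t, γ.deriv t⟫ := integral_nonneg fun t => real_inner_self_nonneg
    exact add_nonneg h1 h2
  add_left γ η ζ := by
    have h1 : ∫ t, ⟪γ.curve t + η.curve t, ζ.curve t⟫
        = (∫ t, ⟪γ.curve t, ζ.curve t⟫) + ∫ t, ⟪η.curve t, ζ.curve t⟫ := by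
      simp_rw [inner_add_left]
      exact integral_add (continuous_integrable (by fun_prop)) (continuous_integrable (by fun_prop))
    have h2 : ⟪γ.deriv + η.deriv, ζ.deriv⟫ = ⟪γ.deriv, ζ.deriv⟫ + ⟪η.deriv, ζ.deriv⟫ :=
      inner_add_left _ _ _
    rw [L2.inner_def, L2.inner_def, L2.inner_def] at h2
    change (∫ t, ⟪γ.curve t + η.curve t, ζ.curve t⟫) + ∫ t, ⟪(γ.deriv + η.deriv) t, ζ.deriv t⟫ = _
    rw [h1, h2]
    ring
  smul_left γ η c := by
    have h1 : ∫ t, ⟪c • γ.curve t, η.curve t⟫ = c * ∫ t, ⟪γ.curve t, η.curve t⟫ := by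
      simp_rw [real_inner_smul_left]
      exact integral_const_mul _ _
    have h2 : ⟪c • γ.deriv, η.deriv⟫ = c * ⟪γ.deriv, η.deriv⟫ := real_inner_smul_left _ _ _
    rw [L2.inner_def, L2.inner_def] at h2
    change (∫ t, ⟪c • γ.curve t, η.curve t⟫) + ∫ t, ⟪(c • γ.deriv) t, η.deriv t⟫ = _
    rw [h1, h2, ← mul_add]
    rfl
  definite γ h := by
    have h1 : 0 ≤ ∫ t, ⟪γ.curve t, γ.curve t⟫ := integral_nonneg fun t => real_inner_self_nonneg
    have h2 : 0 ≤ ∫ t, ⟪γ.deriv t, γ.deriv t⟫ := integral_nonneg fun t => real_inner_self_nonneg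
    have h3 : (∫ t, ⟪γ.curve t, γ.curve t⟫) + ∫ t, ⟪γ.deriv t, γ.deriv t⟫ = 0 := h
    have h4 : ⟪γ.deriv, γ.deriv⟫ = 0 := by rw [L2.inner_def]; linarith
    have h5 : γ.deriv = 0 := inner_self_eq_zero.1 h4
    have h6 : ∫ t, ‖γ.curve t‖ ^ 2 = 0 := by
      simp_rw [← real_inner_self_eq_norm_sq]; linarith
    refine Subtype.ext (Prod.ext (ContinuousMap.ext fun t => ?_) h5)
    have h7 := γ.norm_curve_le t
    rw [h6, h5] at h7
    simpa using! h7

instance : NormedAddCommGroup (H1 d) := (H1.core d).toNormedAddCommGroup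
instance : InnerProductSpace ℝ (H1 d) := InnerProductSpace.ofCore (H1.core d).toCore

theorem H1.inner_def (γ η : H1 d) :
    ⟪γ, η⟫ = (∫ t, ⟪γ.curve t, η.curve t⟫) + ∫ t, ⟪γ.deriv t, η.deriv t⟫ := rfl

theorem H1.norm_sq_eq (γ : H1 d) :
    ‖γ‖ ^ 2 = (∫ t, ‖γ.curve t‖ ^ 2) + ‖γ.deriv‖ ^ 2 := by
  rw [← real_inner_self_eq_norm_sq, H1.inner_def, ← real_inner_self_eq_norm_sq γ.deriv,
    L2.inner_def]
  simp_rw [real_inner_self_eq_norm_sq]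

/-- The inclusion of `H¹` into `C([0,1]) × L²`. -/
def H1.incl (d : ℕ) : H1 d →ₗ[ℝ]
    C(I, EuclideanSpace ℝ (Fin d)) × Lp (EuclideanSpace ℝ (Fin d)) 2 (volume : Measure I) :=
  (h1Submodule d).subtype

theorem H1.norm_incl_le (γ : H1 d) : ‖H1.incl d γ‖ ≤ 2 * ‖γ‖ := by
  have h := γ.norm_sq_eq
  have h0 : 0 ≤ ∫ t, ‖γ.curve t‖ ^ 2 := integral_nonneg fun t => by positivity
  have h1 : ‖γ.deriv‖ ≤ ‖γ‖ := by
    refine (sq_le_sq₀ (norm_nonneg _) (norm_nonneg _)).1 (by linarith)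
  have h2 : √(∫ t, ‖γ.curve t‖ ^ 2) ≤ ‖γ‖ :=
    Real.sqrt_le_iff.2 ⟨norm_nonneg _, by nlinarith [norm_nonneg γ.deriv]⟩
  have h3 : ‖γ.curve‖ ≤ 2 * ‖γ‖ := by
    refine (ContinuousMap.norm_le _ (by positivity)).2 fun t => ?_
    have := γ.norm_curve_le t
    linarith
  exact max_le h3 (by linarith [norm_nonneg γ] : ‖γ.deriv‖ ≤ 2 * ‖γ‖)

theorem H1.norm_le_incl (γ : H1 d) : ‖γ‖ ≤ 2 * ‖H1.incl d γ‖ := by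
  have h := γ.norm_sq_eq
  have h1 : ‖γ.curve‖ ≤ ‖H1.incl d γ‖ := norm_fst_le (H1.incl d γ)
  have h2 : ‖γ.deriv‖ ≤ ‖H1.incl d γ‖ := norm_snd_le (H1.incl d γ)
  have h3 : ∫ t, ‖γ.curve t‖ ^ 2 ≤ ∫ _ : I, ‖γ.curve‖ ^ 2 := by
    refine integral_mono (continuous_integrable (by fun_prop)) (integrable_const _) fun t => ?_
    exact pow_le_pow_left₀ (norm_nonneg _) (γ.curve.norm_coe_le_norm t) 2
  rw [integral_const] at h3
  simp only [probReal_univ, one_smul] at h3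
  refine (sq_le_sq₀ (norm_nonneg _) (by positivity)).1 ?_
  nlinarith [norm_nonneg γ.curve, norm_nonneg γ.deriv]

theorem continuous_setIntegral_lp (t : I) :
    Continuous fun v : Lp (EuclideanSpace ℝ (Fin d)) 2 (volume : Measure I) =>
      ∫ s in Set.Iic t, v s := by
  refine (LipschitzWith.of_dist_le_mul (K := 1) fun v w => ?_).continuous
  have h : ∫ s in Set.Iic t, (v - w) s = (∫ s in Set.Iic t, v s) - ∫ s in Set.Iic t, w s := by
    rw [integral_congr_ae (ae_restrict_of_ae (Lp.coeFn_sub v w))]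
    exact integral_sub (integrable_lp v).integrableOn (integrable_lp w).integrableOn
  rw [dist_eq_norm, dist_eq_norm, ← h, NNReal.coe_one, one_mul]
  refine (norm_integral_le_integral_norm _).trans ((setIntegral_le_integral
    (integrable_lp _).norm (ae_of_all _ fun _ => norm_nonneg _)).trans (integral_norm_lp_le _))

theorem isClosed_h1Submodule (d : ℕ) : IsClosed (h1Submodule d : Set
    (C(I, EuclideanSpace ℝ (Fin d)) × Lp (EuclideanSpace ℝ (Fin d)) 2 (volume : Measure I))) := by
  have : (h1Submodule d : Set (C(I, EuclideanSpace ℝ (Fin d)) ×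
      Lp (EuclideanSpace ℝ (Fin d)) 2 (volume : Measure I))) =
      ⋂ t : I, {p | p.1 t = p.1 0 + ∫ s in Set.Iic t, p.2 s} := by
    ext p
    simp [h1Submodule]
  rw [this]
  refine isClosed_iInter fun t => isClosed_eq ?_ ?_
  · exact (continuous_eval_const t).comp continuous_fst
  · exact ((continuous_eval_const 0).comp continuous_fst).add
      ((continuous_setIntegral_lp t).comp continuous_snd)

instance : CompleteSpace (H1 d) := by
  have hanti : AntilipschitzWith 2 (H1.incl d) :=
    AddMonoidHomClass.antilipschitz_of_bound (H1.incl d) (K := 2) fun γ => H1.norm_le_incl γ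
  have hlip : LipschitzWith (Real.toNNReal 2) (H1.incl d) :=
    AddMonoidHomClass.lipschitz_of_bound (H1.incl d) 2 fun γ => H1.norm_incl_le γ
  rw [completeSpace_iff_isComplete_range (hanti.isUniformInducing hlip.uniformContinuous)]
  have hr : Set.range (H1.incl d) = (h1Submodule d : Set _) := Subtype.range_coe
  rw [hr]
  exact (isClosed_h1Submodule d).isComplete

end H1

/-! ### The insertion functional and descent sequences -/

section Functional

variable {d : ℕ}

/-- `W(γ) = -∫₀¹ w_t(γ(t)) dt`. -/
def functionalW (w : I → EuclideanSpace ℝ (Fin d) → ℝ) (γ : H1 d) : ℝ :=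
  -∫ t, w t (γ.curve t)

/-- `L(γ) = β/2 ∫₀¹ |γ'(t)|² dt + α`. -/
def functionalL (α β : ℝ) (γ : H1 d) : ℝ :=
  β / 2 * (∫ t, ‖γ.deriv t‖ ^ 2) + α

/-- The insertion functional `F = W / L`. -/
def functionalF (w : I → EuclideanSpace ℝ (Fin d) → ℝ) (α β : ℝ) (γ : H1 d) : ℝ :=
  functionalW w γ / functionalL α β γ

variable {V : Type*} [NormedAddCommGroup V] [InnerProductSpace ℝ V] [CompleteSpace V]

/-- Sufficient decrease (Armijo) condition with parameter `c` for the gradient step of size `δ`. -/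
def SufficientDecrease (F : V → ℝ) (c δ : ℝ) (x : V) : Prop :=
  F (x - δ • gradient F x) ≤ F x - c * δ * ‖gradient F x‖ ^ 2

/-- Armijo-Goldstein rule: every step is positive and satisfies the two-sided condition
`F(x) - c₂ δ ‖∇F(x)‖² ≤ F(x - δ ∇F(x)) ≤ F(x) - c₁ δ ‖∇F(x)‖²` with fixed `0 < c₁ < c₂ < 1`. -/
def ArmijoGoldsteinRule (F : V → ℝ) (x : ℕ → V) (δ : ℕ → ℝ) : Prop :=
  ∃ c₁ c₂ : ℝ, 0 < c₁ ∧ c₁ < c₂ ∧ c₂ < 1 ∧ ∀ n, 0 < δ n ∧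
    SufficientDecrease F c₁ (δ n) (x n) ∧
    F (x n) - c₂ * δ n * ‖gradient F (x n)‖ ^ 2 ≤ F (x n - δ n • gradient F (x n))

/-- Backtracking-Armijo rule: with fixed initial step `δ₀ > 0`, reduction factor `τ ∈ (0,1)` and
parameter `c ∈ (0,1)`, the step is the first among `δ₀, τ δ₀, τ² δ₀, …` with sufficient decrease. -/
def BacktrackingArmijoRule (F : V → ℝ) (x : ℕ → V) (δ : ℕ → ℝ) : Prop :=
  ∃ δ₀ τ c : ℝ, 0 < δ₀ ∧ 0 < τ ∧ τ < 1 ∧ 0 < c ∧ c < 1 ∧ ∀ n, ∃ k : ℕ,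
    δ n = τ ^ k * δ₀ ∧ SufficientDecrease F c (δ n) (x n) ∧
    ∀ j < k, ¬ SufficientDecrease F c (τ ^ j * δ₀) (x n)

/-- Descent sequences: gradient descent started at negative energy, with step sizes chosen by the
Armijo-Goldstein or by the backtracking-Armijo rule. -/
def IsDescentSequence (F : V → ℝ) (x : ℕ → V) : Prop :=
  F (x 0) < 0 ∧ ∃ δ : ℕ → ℝ, (∀ n, x (n + 1) = x n - δ n • gradient F (x n)) ∧
    (ArmijoGoldsteinRule F x δ ∨ BacktrackingArmijoRule F x δ)

end Functional

end DynamicInverse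

end

/-! The values of K_t h at x are the inner products of h with K_t^* δ_x. Hence the dual variable is
measurable in time, and in space it is C^{1,1} with all bounds dominated by the integrable function
a(t) = C(CM + ‖f_t‖), where M bounds the functionals ρ_t. As E lies inside the open set Ω, extension
by zero loses no regularity (`exists_isC11Integrand`). Thus W and F = W/L are C¹ on H¹, and F' is
bounded and Lipschitz on balls, because L ≥ α.

On {F ≤ -m} with m > 0, the bound |W| ≤ ∫a forces L ≤ (∫a)/m, and the curve must meet E, since
otherwise W = 0. Such sets are therefore bounded (`IsC11Integrand.exists_norm_le`). A descent
sequence stays in one of them, and either step rule then gives F'(γ^n) → 0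
(`tendsto_gradient_zero`).

Compactness rests on L F' = W' - βF ⟪γ', ·⟫ (`derivF_identity`). At negative levels the factor -βF
is at least βm, while W' sees its argument only through the sup norm, for which H¹-bounded sequences
are precompact by Arzelà–Ascoli. Hence the derivatives are Cauchy in L² along a subsequence, which
is the Palais–Smale condition (`IsC11Integrand.exists_tendsto_subseq`).

A critical curve stays in E by a maximum principle (`IsC11Integrand.range_curve_subset`). For a
half-space {⟪v, x⟫ ≤ c} containing E, test with η = ψ(⟪v, γ⟫ - c) v, where ψ is nondecreasing and
vanishes exactly on (-∞, 0]. The W' term vanishes, so ∫ ψ'(⟪v, γ⟫ - c) ⟪v, γ'⟫² = 0, and η is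
constant. It is zero whenever γ is in E, so γ never leaves the half-space. -/

noncomputable section

namespace DynamicInverse

/-! ### Extension by zero of `C^{1,1}` functions with compact support in an open set -/

section Extension

variable {d : ℕ} {Ω E : Set (EuclideanSpace ℝ (Fin d))}

open Classical in
/-- Extension by zero of the gradient of an element of `C^{1,1}(closure Ω)`. -/
def C11.extGrad (φ : C11 (closure Ω)) (x : EuclideanSpace ℝ (Fin d)) : EuclideanSpace ℝ (Fin d) :=
  if hx : x ∈ closure Ω then φ.grad ⟨x, hx⟩ else 0

open Classical in
/-- Extension by zero of an element of `C^{1,1}(closure Ω)`. -/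
def C11.ext₀ (φ : C11 (closure Ω)) (x : EuclideanSpace ℝ (Fin d)) : ℝ :=
  if hx : x ∈ closure Ω then φ.toBCF ⟨x, hx⟩ else 0

theorem C11.abs_toBCF_le {S : Set (EuclideanSpace ℝ (Fin d))} (φ : C11 S) (x : S) :
    |φ.toBCF x| ≤ ‖φ‖ := by
  have h := φ.toBCF.norm_coe_le_norm x
  rw [C11.norm_def]
  have := norm_nonneg φ.grad
  have : (0 : ℝ) ≤ nnHolderNorm 1 φ.grad := by positivity
  rw [Real.norm_eq_abs] at h
  linarith

theorem C11.norm_grad_le {S : Set (EuclideanSpace ℝ (Fin d))} (φ : C11 S) (x : S) :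
    ‖φ.grad x‖ ≤ ‖φ‖ := by
  have h := φ.grad.norm_coe_le_norm x
  rw [C11.norm_def]
  have := norm_nonneg φ.toBCF
  have : (0 : ℝ) ≤ nnHolderNorm 1 φ.grad := by positivity
  linarith

theorem C11.norm_grad_sub_le {S : Set (EuclideanSpace ℝ (Fin d))} (φ : C11 S) (x y : S) :
    ‖φ.grad x - φ.grad y‖ ≤ ‖φ‖ * ‖(x : EuclideanSpace ℝ (Fin d)) - y‖ := by
  have h := (holderWith_one.1 φ.memHolder.holderWith).dist_le_mul x y
  rw [dist_eq_norm, Subtype.dist_eq, dist_eq_norm] at h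
  refine h.trans (mul_le_mul_of_nonneg_right ?_ (norm_nonneg _))
  rw [C11.norm_def]
  have := norm_nonneg φ.toBCF
  have := norm_nonneg φ.grad
  linarith

theorem C11.abs_ext₀_le (φ : C11 (closure Ω)) (x : EuclideanSpace ℝ (Fin d)) :
    |φ.ext₀ x| ≤ ‖φ‖ := by
  unfold C11.ext₀
  split_ifs with h
  · exact φ.abs_toBCF_le _
  · simp

theorem C11.norm_extGrad_le (φ : C11 (closure Ω)) (x : EuclideanSpace ℝ (Fin d)) :
    ‖φ.extGrad x‖ ≤ ‖φ‖ := by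
  unfold C11.extGrad
  split_ifs with h
  · exact φ.norm_grad_le _
  · simp

theorem C11.ext₀_eq_zero (φ : C11 (closure Ω)) (h : Subtype.val '' tsupport φ.toBCF ⊆ E)
    {x : EuclideanSpace ℝ (Fin d)} (hx : x ∉ E) : φ.ext₀ x = 0 := by
  unfold C11.ext₀
  split_ifs with hx'
  · exact image_eq_zero_of_notMem_tsupport fun hmem => hx (h ⟨_, hmem, rfl⟩)
  · rfl

theorem C11.extGrad_eq_zero (φ : C11 (closure Ω)) (h : Subtype.val '' tsupport φ.grad ⊆ E)
    {x : EuclideanSpace ℝ (Fin d)} (hx : x ∉ E) : φ.extGrad x = 0 := by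
  unfold C11.extGrad
  split_ifs with hx'
  · exact image_eq_zero_of_notMem_tsupport fun hmem => hx (h ⟨_, hmem, rfl⟩)
  · rfl

/-- Otherwise U and the complement of its closure would disconnect the segment. -/
theorem exists_mem_segment_closure_diff {V : Type*} [NormedAddCommGroup V] [NormedSpace ℝ V]
    {U : Set V} (hU : IsOpen U) {x y : V} (hx : x ∈ U) (hy : y ∉ U) :
    ∃ z ∈ segment ℝ x y, z ∈ closure U ∧ z ∉ U := by
  by_contra! hcon
  have hpre := (convex_segment (𝕜 := ℝ) x y).isPreconnected
  have := hpre U (closure U)ᶜ hU isClosed_closure.isOpen_compl (fun z hz => ?_)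
    ⟨x, left_mem_segment ℝ x y, hx⟩
    ⟨y, right_mem_segment ℝ x y, fun h => hy (hcon y (right_mem_segment ℝ x y) h)⟩
  · obtain ⟨z, -, hz1, hz2⟩ := this
    exact hz2 (subset_closure hz1)
  · by_cases h : z ∈ closure U
    · exact Or.inl (hcon z hz h)
    · exact Or.inr h

/-- Only a pair x ∈ E, y outside the closure needs an argument. The segment meets the boundary of Ω
at some z, where the gradient already vanishes because E ⊆ Ω, and z is no farther from x than y is.
The Lipschitz constant is thus unchanged. -/
theorem C11.norm_extGrad_sub_le (φ : C11 (closure Ω)) (hΩ : IsOpen Ω) (hE : E ⊆ Ω)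
    (h : Subtype.val '' tsupport φ.grad ⊆ E) (x y : EuclideanSpace ℝ (Fin d)) :
    ‖φ.extGrad x - φ.extGrad y‖ ≤ ‖φ‖ * ‖x - y‖ := by
  have hin : ∀ x ∈ closure Ω, ∀ y ∈ closure Ω,
      ‖φ.extGrad x - φ.extGrad y‖ ≤ ‖φ‖ * ‖x - y‖ := by
    intro x hx y hy
    simp only [C11.extGrad, hx, hy, dif_pos]
    exact φ.norm_grad_sub_le ⟨x, hx⟩ ⟨y, hy⟩
  have hout : ∀ x ∈ closure Ω, ∀ y ∉ closure Ω,
      ‖φ.extGrad x - φ.extGrad y‖ ≤ ‖φ‖ * ‖x - y‖ := by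
    intro x hx y hy
    have hy0 : φ.extGrad y = 0 := dif_neg hy
    by_cases hxE : x ∈ E
    · obtain ⟨z, hz, hz1, hz2⟩ :=
        exists_mem_segment_closure_diff hΩ (hE hxE) fun h => hy (subset_closure h)
      have hz0 : φ.extGrad z = 0 := φ.extGrad_eq_zero h fun h => hz2 (hE h)
      have h1 := hin x hx z hz1
      have h2 := dist_add_dist_of_mem_segment hz
      rw [dist_eq_norm, dist_eq_norm, dist_eq_norm] at h2
      rw [hy0, ← hz0]
      refine h1.trans (mul_le_mul_of_nonneg_left ?_ (norm_nonneg _))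
      linarith [norm_nonneg (z - y)]
    · rw [hy0, φ.extGrad_eq_zero h hxE]
      simp only [sub_zero, norm_zero]
      positivity
  by_cases hx : x ∈ closure Ω <;> by_cases hy : y ∈ closure Ω
  · exact hin x hx y hy
  · exact hout x hx y hy
  · rw [norm_sub_rev, norm_sub_rev x]
    exact hout y hy x hx
  · simp only [C11.extGrad, hx, hy, dif_neg, not_false_eq_true, sub_zero, norm_zero]
    positivity

/-- Points of E are interior to the closure of Ω, so relative differentiability there is genuine.
The complement of E is open and the function vanishes on it. -/
theorem C11.hasGradientAt_ext₀ (φ : C11 (closure Ω)) (hΩ : IsOpen Ω) (hEc : IsClosed E)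
    (hE : E ⊆ Ω) (h : Subtype.val '' tsupport φ.toBCF ⊆ E)
    (h' : Subtype.val '' tsupport φ.grad ⊆ E) (x : EuclideanSpace ℝ (Fin d)) :
    HasGradientAt φ.ext₀ (φ.extGrad x) x := by
  by_cases hx : x ∈ E
  · have hxc : x ∈ closure Ω := subset_closure (hE hx)
    have hnhds : closure Ω ∈ 𝓝 x := mem_of_superset (hΩ.mem_nhds (hE hx)) subset_closure
    rw [hasGradientAt_iff_isLittleO, ← map_nhds_subtype_coe_eq_nhds hxc hnhds, isLittleO_map]
    refine (φ.2.1 ⟨x, hxc⟩).congr_left fun y => ?_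
    have hy : φ.ext₀ y = φ.toBCF y := dif_pos y.2
    have hx : φ.ext₀ x = φ.toBCF ⟨x, hxc⟩ := dif_pos hxc
    have hg : φ.extGrad x = φ.grad ⟨x, hxc⟩ := dif_pos hxc
    simp only [Function.comp_apply, hx, hy, hg]
    rfl
  · rw [φ.extGrad_eq_zero h' hx]
    have : φ.ext₀ =ᶠ[𝓝 x] fun _ => 0 := by
      filter_upwards [hEc.isOpen_compl.mem_nhds hx] with y hy using φ.ext₀_eq_zero h hy
    exact (hasGradientAt_const x (0 : ℝ)).congr_of_eventuallyEq this

end Extension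

/-! ### Pre-adjoint bounds and point evaluations -/

section PreAdjoint

theorem norm_preAdjoint_le {X : Type*} [NormedAddCommGroup X] [NormedSpace ℝ X]
    {Y : Type*} [NormedAddCommGroup Y] [InnerProductSpace ℝ Y] {T : StrongDual ℝ X →L[ℝ] Y}
    (hT : WeakStarToWeakContinuous T) (y : Y) : ‖preAdjoint T y‖ ≤ ‖T‖ * ‖y‖ := by
  refine NormedSpace.norm_le_dual_bound ℝ _ (by positivity) fun ξ => ?_
  rw [preAdjoint_spec hT]
  refine (norm_inner_le_norm _ _).trans ?_
  have := T.le_opNorm ξ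
  nlinarith [norm_nonneg y]

/-- Evaluation at x is integration against the Dirac measure. This turns point values into inner
products in H_t, for which measurability is available. -/
theorem preAdjoint_apply_eq {d : ℕ} {S : Set (EuclideanSpace ℝ (Fin d))}
    {Y : Type*} [NormedAddCommGroup Y] [InnerProductSpace ℝ Y]
    {T : StrongDual ℝ (C11 S) →L[ℝ] Y} (hT : WeakStarToWeakContinuous T) (y : Y) (x : S) :
    (preAdjoint T y).toBCF x = ⟪T (measureToDual (VectorMeasure.dirac x (1 : ℝ))), y⟫ := by
  rw [← preAdjoint_spec hT, measureToDual_apply, VectorMeasure.integral_dirac]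
  simp

end PreAdjoint

/-! ### Measurability of time-dependent quantities -/

section Measurability

theorem aemeasurable_simpleFunc_diagonal {h : I → I → ℝ}
    (h1 : ∀ s, AEMeasurable fun t => h t s) (r : SimpleFunc I I) :
    AEMeasurable fun t => h t (r t) := by
  have hu : (⋃ c : r.range, r ⁻¹' {(c : I)}) = Set.univ := by
    exact Set.eq_univ_of_forall fun t => Set.mem_iUnion.2 ⟨⟨r t, r.mem_range_self t⟩, rfl⟩
  rw [← Measure.restrict_univ (μ := (volume : Measure I)), ← hu, aemeasurable_iUnion_iff]
  intro c
  refine ((h1 c).restrict (s := r ⁻¹' {(c : I)})).congr ?_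
  filter_upwards [ae_restrict_mem (r.measurableSet_fiber c)] with t ht
  rw [show r t = c from ht]

/-- Functions `h` measurable in the first and continuous in the second variable have a measurable
diagonal. -/
theorem aemeasurable_diagonal {h : I → I → ℝ} (h1 : ∀ s, AEMeasurable fun t => h t s)
    (h2 : ∀ᵐ t : I, Continuous (h t)) : AEMeasurable fun t => h t t := by
  -- Approximate the identity by simple functions r_n. Each h t (r_n t) is measurable piecewise, and
  -- continuity in the second variable passes to the limit.
  have hid : StronglyMeasurable (id : I → I) := measurable_id.stronglyMeasurable
  refine aemeasurable_of_tendsto_metrizable_ae atTop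
    (fun n => aemeasurable_simpleFunc_diagonal h1 (hid.approx n)) ?_
  filter_upwards [h2] with t ht
  exact (ht.tendsto t).comp (hid.tendsto_approx t)

variable {D : Type*} [NormedAddCommGroup D] [NormedSpace ℝ D]
  {H : I → Type*} [∀ t, NormedAddCommGroup (H t)] [∀ t, InnerProductSpace ℝ (H t)]

theorem IsStepMap.aemeasurable_inner {i : ∀ t, D →L[ℝ] H t} (hi : SamplingAssumptions i)
    {f g : ∀ t, H t} (hf : IsStepMap i f) (hg : IsStepMap i g) :
    AEMeasurable fun t => ⟪f t, g t⟫ := by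
  obtain ⟨N, A, φ, hA, hf⟩ := hf
  obtain ⟨M, B, ψ, hB, hg⟩ := hg
  have : (fun t => ⟪f t, g t⟫) = fun t => ∑ j, ∑ k,
      (A j ∩ B k).indicator (fun t => ⟪i t (φ j), i t (ψ k)⟫) t := by
    funext t
    rw [hf, hg, sum_inner]
    refine Finset.sum_congr rfl fun j _ => ?_
    rw [inner_sum]
    refine Finset.sum_congr rfl fun k _ => ?_
    by_cases h1 : t ∈ A j <;> by_cases h2 : t ∈ B k <;> simp [h1, h2]
  rw [this]
  refine Finset.aemeasurable_fun_sum _ fun j _ => Finset.aemeasurable_fun_sum _ fun k _ => ?_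
  exact (hi.measurable _ _).indicator ((hA j).inter (hB k))

theorem StronglyMeasurableMap.aemeasurable_inner {i : ∀ t, D →L[ℝ] H t}
    (hi : SamplingAssumptions i) {f g : ∀ t, H t} (hf : StronglyMeasurableMap i f)
    (hg : StronglyMeasurableMap i g) : AEMeasurable fun t => ⟪f t, g t⟫ := by
  obtain ⟨s, hs, hsf⟩ := hf
  obtain ⟨r, hr, hrg⟩ := hg
  refine aemeasurable_of_tendsto_metrizable_ae atTop
    (fun n => (hs n).aemeasurable_inner hi (hr n)) ?_
  filter_upwards [hsf, hrg] with t h1 h2 using h1.inner h2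

end Measurability

/-! ### Uniform bounds for narrowly continuous curves of measures -/

section Narrow

variable {d : ℕ} {S : Set (EuclideanSpace ℝ (Fin d))}

/-- Integration against a signed measure on a compact set as a functional on continuous
functions. -/
def measureFunctional [CompactSpace S] (ρ : SignedMeasure S) : C(S, ℝ) →L[ℝ] ℝ :=
  LinearMap.mkContinuous
    { toFun := fun φ => ∫ᵛ x, φ x ∂•ρ
      map_add' := fun φ ψ => VectorMeasure.integral_fun_add
        (integrable_bcf ρ (BoundedContinuousFunction.mkOfCompact φ))
        (integrable_bcf ρ (BoundedContinuousFunction.mkOfCompact ψ))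
      map_smul' := fun c φ => VectorMeasure.integral_fun_smul ρ _ c φ }
    (ρ.variation.real Set.univ) fun φ => by
      have := isFiniteMeasure_variation ρ
      refine (VectorMeasure.norm_integral_le_of_norm_le_const (C := ‖φ‖)
        (ae_of_all _ φ.norm_coe_le_norm)).trans ?_
      rw [ContinuousLinearMap.opNorm_lsmul, mul_one, mul_comm]

/-- Continuity on the compact interval bounds each t ↦ ∫ φ dρ_t, so the uniform boundedness
principle applies on C(S). The bound transfers to C^{1,1} since the sup norm is the weaker one. -/
theorem NarrowlyContinuous.exists_norm_measureToDual_le [CompactSpace S] {ρ : I → SignedMeasure S}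
    (hρ : NarrowlyContinuous ρ) : ∃ M, 0 ≤ M ∧ ∀ t, ‖measureToDual (ρ t)‖ ≤ M := by
  obtain ⟨M, hM⟩ := banach_steinhaus (g := fun t => measureFunctional (ρ t)) fun φ => by
    obtain ⟨C, hC⟩ := isCompact_univ.exists_bound_of_continuousOn (hρ φ).continuousOn
    exact ⟨C, fun t => hC t (Set.mem_univ t)⟩
  have hM0 : 0 ≤ M := (norm_nonneg _).trans (hM 0)
  refine ⟨M, hM0, fun t => ContinuousLinearMap.opNorm_le_bound _ hM0 fun φ => ?_⟩
  have h1 := (measureFunctional (ρ t)).le_of_opNorm_le (hM t) φ.toBCF.toContinuousMap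
  refine h1.trans (mul_le_mul_of_nonneg_left ?_ hM0)
  exact (ContinuousMap.norm_le _ (norm_nonneg _)).2 φ.abs_toBCF_le

end Narrow

/-! ### Regularity of the dual variable -/

section DualVariable

/-- Integrands `w` measurable in time and, for almost every time `t`, of class `C^{1,1}` in space
with gradient `G t`, bounds `a t` and support in `E`. -/
structure IsC11Integrand {V : Type*} [NormedAddCommGroup V] [InnerProductSpace ℝ V]
    [CompleteSpace V] (w : I → V → ℝ) (G : I → V → V) (a : I → ℝ) (E : Set V) : Prop where
  integrable : Integrable a
  aemeasurable : ∀ x, AEMeasurable fun t => w t x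
  hasGradientAt : ∀ᵐ t : I, ∀ x, HasGradientAt (w t) (G t x) x
  abs_le : ∀ᵐ t : I, ∀ x, |w t x| ≤ a t
  norm_grad_le : ∀ᵐ t : I, ∀ x, ‖G t x‖ ≤ a t
  norm_grad_sub_le : ∀ᵐ t : I, ∀ x y, ‖G t x - G t y‖ ≤ a t * ‖x - y‖
  eq_zero : ∀ᵐ t : I, ∀ x, x ∉ E → w t x = 0
  grad_eq_zero : ∀ᵐ t : I, ∀ x, x ∉ E → G t x = 0

variable {d : ℕ} {Ω E : Set (EuclideanSpace ℝ (Fin d))}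
  {D : Type*} [NormedAddCommGroup D] [NormedSpace ℝ D]
  {H : I → Type*} [∀ t, NormedAddCommGroup (H t)] [∀ t, InnerProductSpace ℝ (H t)]
  {i : ∀ t, D →L[ℝ] H t} {Kstar : ∀ t, StrongDual ℝ (C11 (closure Ω)) →L[ℝ] H t}
  {ρ : I → SignedMeasure (closure Ω)} {f : ∀ t, H t}

/-- The spatial gradient of the dual variable. -/
def dualGradient (Kstar : ∀ t, StrongDual ℝ (C11 (closure Ω)) →L[ℝ] H t)
    (ρ : I → SignedMeasure (closure Ω)) (f : ∀ t, H t) (t : I) :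
    EuclideanSpace ℝ (Fin d) → EuclideanSpace ℝ (Fin d) :=
  (-preAdjoint (Kstar t) (Kstar t (measureToDual (ρ t)) - f t)).extGrad

/-- In ⟪K_t^* δ_x, K_t^* ρ_t⟫ the measure also moves with t, which the measurability assumption on
K_t^* does not cover directly. Decoupling the times as ⟪K_t^* δ_x, K_t^* ρ_s⟫ gives measurability in
t for fixed s, and continuity in s for fixed t, as this is the integral of K_t K_t^* δ_x against
ρ_s. Then `aemeasurable_diagonal` applies. -/
theorem aemeasurable_dualVariable (hi : SamplingAssumptions i)
    (hK : ForwardAssumptions Ω E i Kstar) (hρ : NarrowlyContinuous ρ)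
    (hf : StronglyMeasurableMap i f) [CompactSpace (closure Ω)] (x : EuclideanSpace ℝ (Fin d)) :
    AEMeasurable fun t => dualVariable Kstar ρ f t x := by
  by_cases hx : x ∈ closure Ω
  swap
  · simp only [dualVariable, hx, dif_neg, not_false_eq_true]
    exact aemeasurable_const
  set δ := measureToDual (VectorMeasure.dirac (⟨x, hx⟩ : closure Ω) (1 : ℝ))
  have hδ := hK.stronglyMeasurable (VectorMeasure.dirac (⟨x, hx⟩ : closure Ω) (1 : ℝ))
  have h1 : AEMeasurable fun t => ⟪Kstar t δ, Kstar t (measureToDual (ρ t))⟫ := by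
    refine aemeasurable_diagonal (h := fun t s => ⟪Kstar t δ, Kstar t (measureToDual (ρ s))⟫)
      (fun s => hδ.aemeasurable_inner hi (hK.stronglyMeasurable (ρ s))) ?_
    filter_upwards [hK.weak_continuous] with t ht
    have : (fun s => ⟪Kstar t δ, Kstar t (measureToDual (ρ s))⟫) = fun s =>
        ∫ᵛ y, (preAdjoint (Kstar t) (Kstar t δ)).toBCF y ∂•(ρ s) := by
      funext s
      rw [← measureToDual_apply, preAdjoint_spec ht, real_inner_comm]
    rw [this]
    exact hρ (preAdjoint (Kstar t) (Kstar t δ)).toBCF.toContinuousMap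
  refine ((hδ.aemeasurable_inner hi hf).sub h1).congr ?_
  filter_upwards [hK.weak_continuous] with t ht
  have h2 : dualVariable Kstar ρ f t x =
      -(preAdjoint (Kstar t) (Kstar t (measureToDual (ρ t)) - f t)).toBCF ⟨x, hx⟩ := dif_pos hx
  rw [h2, preAdjoint_apply_eq ht, inner_sub_right]
  simp only [Pi.sub_apply, δ]
  ring

theorem exists_isC11Integrand (hΩ_open : IsOpen Ω) [CompactSpace (closure Ω)]
    (hi : SamplingAssumptions i) (hK : ForwardAssumptions Ω E i Kstar)
    (hρ : NarrowlyContinuous ρ) (hf : MemL2H i f) :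
    ∃ a, IsC11Integrand (dualVariable Kstar ρ f) (dualGradient Kstar ρ f) a E := by
  obtain ⟨M, hM0, hM⟩ := hρ.exists_norm_measureToDual_le
  obtain ⟨C, hC0, hC⟩ := hK.bound
  have hE : E ⊆ Ω := hK.isClosed.closure_eq ▸ hK.compactly_contained.2
  -- Domination by 1 + ‖f_t‖²; measurability is recovered as the square root of ‖f_t‖².
  have hfint : Integrable fun t => ‖f t‖ := by
    refine ((integrable_const (1 : ℝ)).add hf.2).mono' ?_ (ae_of_all _ fun t => ?_)
    · have := (Real.continuous_sqrt.comp_aestronglyMeasurable hf.2.aestronglyMeasurable)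
      refine this.congr (ae_of_all _ fun t => ?_)
      exact Real.sqrt_sq (norm_nonneg _)
    · simp only [norm_norm, Pi.add_apply]
      nlinarith [sq_nonneg (‖f t‖ - 1)]
  have hφ : ∀ᵐ t : I, ‖-preAdjoint (Kstar t) (Kstar t (measureToDual (ρ t)) - f t)‖ ≤
      C * (C * M + ‖f t‖) := by
    filter_upwards [hC, hK.weak_continuous] with t ht ht'
    rw [norm_neg]
    refine (norm_preAdjoint_le ht' _).trans (mul_le_mul ht ?_ (norm_nonneg _) hC0.le)
    refine (norm_sub_le _ _).trans (add_le_add_left ?_ _)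
    exact ((Kstar t).le_opNorm _).trans (mul_le_mul ht (hM t) (norm_nonneg _) hC0.le)
  have hsupp : ∀ᵐ t : I,
      Subtype.val '' tsupport
        (-preAdjoint (Kstar t) (Kstar t (measureToDual (ρ t)) - f t)).toBCF ⊆ E ∧
      Subtype.val '' tsupport
        (-preAdjoint (Kstar t) (Kstar t (measureToDual (ρ t)) - f t)).grad ⊆ E := by
    filter_upwards [hK.support_subset] with t ht
    have h := ht (Kstar t (measureToDual (ρ t)) - f t)
    set φ := preAdjoint (Kstar t) (Kstar t (measureToDual (ρ t)) - f t)
    have h1 : tsupport (-φ).toBCF = tsupport φ.toBCF := tsupport_neg φ.toBCF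
    have h2 : tsupport (-φ).grad = tsupport φ.grad := tsupport_neg φ.grad
    rwa [h1, h2]
  refine ⟨fun t => C * (C * M + ‖f t‖), ?_, aemeasurable_dualVariable hi hK hρ hf.1, ?_, ?_, ?_, ?_,
    ?_, ?_⟩
  · exact ((integrable_const _).add hfint).const_mul _
  · filter_upwards [hsupp] with t ht x
    exact C11.hasGradientAt_ext₀ _ hΩ_open hK.isClosed hE ht.1 ht.2 x
  · filter_upwards [hφ] with t ht x using (C11.abs_ext₀_le _ x).trans ht
  · filter_upwards [hφ] with t ht x using (C11.norm_extGrad_le _ x).trans ht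
  · filter_upwards [hφ, hsupp] with t ht ht' x y
    exact (C11.norm_extGrad_sub_le _ hΩ_open hE ht'.2 x y).trans
      (mul_le_mul_of_nonneg_right ht (norm_nonneg _))
  · filter_upwards [hsupp] with t ht x hx using C11.ext₀_eq_zero _ ht.1 hx
  · filter_upwards [hsupp] with t ht x hx using C11.extGrad_eq_zero _ ht.2 hx

end DualVariable

/-! ### Bounded Lipschitz functions -/

section BddLip

variable {E X : Type*} [SeminormedAddCommGroup E] [SeminormedAddCommGroup X]

/-- `f` is bounded and Lipschitz on `s`. -/
def BddLipOn (f : E → X) (s : Set E) : Prop :=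
  ∃ M, 0 ≤ M ∧ (∀ x ∈ s, ‖f x‖ ≤ M) ∧ ∀ x ∈ s, ∀ y ∈ s, ‖f x - f y‖ ≤ M * ‖x - y‖

theorem BddLipOn.of_bounds {f : E → X} {s : Set E} {M K : ℝ} (h1 : ∀ x ∈ s, ‖f x‖ ≤ M)
    (h2 : ∀ x ∈ s, ∀ y ∈ s, ‖f x - f y‖ ≤ K * ‖x - y‖) : BddLipOn f s :=
  ⟨|M| + |K|, by positivity, fun x hx => (h1 x hx).trans (by linarith [le_abs_self M, abs_nonneg K]),
    fun x hx y hy => (h2 x hx y hy).trans (mul_le_mul_of_nonneg_right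
      (by linarith [le_abs_self K, abs_nonneg M]) (norm_nonneg _))⟩

theorem BddLipOn.sub {f g : E → X} {s : Set E} (hf : BddLipOn f s) (hg : BddLipOn g s) :
    BddLipOn (fun x => f x - g x) s := by
  obtain ⟨M, hM0, hM, hM'⟩ := hf
  obtain ⟨N, hN0, hN, hN'⟩ := hg
  refine .of_bounds (M := M + N) (K := M + N) (fun x hx => ?_) fun x hx y hy => ?_
  · exact (norm_sub_le _ _).trans (add_le_add (hM x hx) (hN x hx))
  · rw [show f x - g x - (f y - g y) = (f x - f y) - (g x - g y) by abel, add_mul]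
    exact (norm_sub_le _ _).trans (add_le_add (hM' x hx y hy) (hN' x hx y hy))

theorem BddLipOn.smul [NormedSpace ℝ X] {f : E → ℝ} {g : E → X} {s : Set E}
    (hf : BddLipOn f s) (hg : BddLipOn g s) : BddLipOn (fun x => f x • g x) s := by
  obtain ⟨M, hM0, hM, hM'⟩ := hf
  obtain ⟨N, hN0, hN, hN'⟩ := hg
  refine .of_bounds (M := M * N) (K := 2 * M * N) (fun x hx => ?_) fun x hx y hy => ?_
  · rw [norm_smul]
    exact mul_le_mul (hM x hx) (hN x hx) (norm_nonneg _) hM0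
  · rw [show f x • g x - f y • g y = (f x - f y) • g x + f y • (g x - g y) by
      rw [sub_smul, smul_sub]; abel]
    refine (norm_add_le _ _).trans ?_
    rw [norm_smul, norm_smul]
    have h1 : ‖f x - f y‖ * ‖g x‖ ≤ M * ‖x - y‖ * N :=
      mul_le_mul (hM' x hx y hy) (hN x hx) (norm_nonneg _) (by positivity)
    have h2 : ‖f y‖ * ‖g x - g y‖ ≤ M * (N * ‖x - y‖) :=
      mul_le_mul (hM y hy) (hN' x hx y hy) (norm_nonneg _) (by positivity)
    linarith

theorem bddLipOn_const (c : X) (s : Set E) : BddLipOn (fun _ => c) s :=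
  .of_bounds (M := ‖c‖) (K := 0) (fun _ _ => le_rfl) fun _ _ _ _ => by simp

theorem BddLipOn.inv {f : E → ℝ} {s : Set E} (hf : BddLipOn f s) {α : ℝ} (hα : 0 < α)
    (h : ∀ x ∈ s, α ≤ f x) : BddLipOn (fun x => (f x)⁻¹) s := by
  obtain ⟨M, hM0, -, hM'⟩ := hf
  refine .of_bounds (M := α⁻¹) (K := α⁻¹ * α⁻¹ * M) (fun x hx => ?_) fun x hx y hy => ?_
  · have := h x hx
    have h1 : 0 < f x := hα.trans_le this
    rw [Real.norm_eq_abs, abs_of_pos (by positivity)]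
    gcongr
  · have h1 := h x hx
    have h2 := h y hy
    have h3 : 0 < f x := hα.trans_le h1
    have h4 : 0 < f y := hα.trans_le h2
    rw [show (f x)⁻¹ - (f y)⁻¹ = (f x)⁻¹ * (f y)⁻¹ * (f y - f x) by field_simp, norm_mul, norm_mul,
      norm_sub_rev, mul_assoc (α⁻¹ * α⁻¹)]
    refine mul_le_mul (mul_le_mul ?_ ?_ (norm_nonneg _) (by positivity)) (hM' x hx y hy)
      (norm_nonneg _) (by positivity)
    · rw [Real.norm_eq_abs, abs_of_pos (by positivity)]
      gcongr
    · rw [Real.norm_eq_abs, abs_of_pos (by positivity)]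
      gcongr

end BddLip

/-! ### The canonical maps out of `H¹` -/

section Maps

variable {d : ℕ}

/-- The embedding of `H¹` into continuous curves. -/
def H1.curveL (d : ℕ) : H1 d →L[ℝ] C(I, EuclideanSpace ℝ (Fin d)) :=
  (ContinuousLinearMap.fst ℝ _ _).comp ((H1.incl d).mkContinuous 2 H1.norm_incl_le)

/-- The weak derivative as a continuous linear map. -/
def H1.derivL (d : ℕ) : H1 d →L[ℝ] Lp (EuclideanSpace ℝ (Fin d)) 2 (volume : Measure I) :=
  (ContinuousLinearMap.snd ℝ _ _).comp ((H1.incl d).mkContinuous 2 H1.norm_incl_le)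

theorem H1.derivL_apply (γ : H1 d) : H1.derivL d γ = γ.deriv := rfl

theorem H1.norm_deriv_le (γ : H1 d) : ‖γ.deriv‖ ≤ ‖γ‖ := by
  have h := γ.norm_sq_eq
  have h0 : 0 ≤ ∫ t, ‖γ.curve t‖ ^ 2 := integral_nonneg fun t => by positivity
  exact (sq_le_sq₀ (norm_nonneg _) (norm_nonneg _)).1 (by linarith)

theorem H1.norm_curve_le_two_mul (γ : H1 d) : ‖γ.curve‖ ≤ 2 * ‖γ‖ :=
  (norm_fst_le (H1.incl d γ)).trans γ.norm_incl_le

theorem H1.norm_le_add (γ : H1 d) : ‖γ‖ ≤ ‖γ.curve‖ + ‖γ.deriv‖ := by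
  have h := γ.norm_sq_eq
  have h3 : ∫ t, ‖γ.curve t‖ ^ 2 ≤ ∫ _ : I, ‖γ.curve‖ ^ 2 := by
    refine integral_mono (continuous_integrable (by fun_prop)) (integrable_const _) fun t => ?_
    exact pow_le_pow_left₀ (norm_nonneg _) (γ.curve.norm_coe_le_norm t) 2
  rw [integral_const] at h3
  simp only [probReal_univ, one_smul] at h3
  refine (sq_le_sq₀ (norm_nonneg _) (by positivity)).1 ?_
  nlinarith [mul_nonneg (norm_nonneg γ.curve) (norm_nonneg γ.deriv)]

end Maps

/-! ### Integral functionals of `C^{1,1}` integrands -/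

section Integrand

variable {d : ℕ} {w : I → EuclideanSpace ℝ (Fin d) → ℝ}
  {G : I → EuclideanSpace ℝ (Fin d) → EuclideanSpace ℝ (Fin d)} {a : I → ℝ}
  {E : Set (EuclideanSpace ℝ (Fin d))}

theorem IsC11Integrand.ae_nonneg (hw : IsC11Integrand w G a E) : ∀ᵐ t : I, 0 ≤ a t := by
  filter_upwards [hw.abs_le] with t ht using (abs_nonneg _).trans (ht 0)

theorem IsC11Integrand.integral_nonneg (hw : IsC11Integrand w G a E) : 0 ≤ ∫ t, a t :=
  integral_nonneg_of_ae hw.ae_nonneg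

/-- The integrand is measurable in time and continuous in space, so `aemeasurable_diagonal` applies
to (t, s) ↦ w_t(c(s)). -/
theorem IsC11Integrand.aemeasurable_comp (hw : IsC11Integrand w G a E)
    (c : C(I, EuclideanSpace ℝ (Fin d))) : AEMeasurable fun t => w t (c t) := by
  refine aemeasurable_diagonal (h := fun t s => w t (c s)) (fun s => hw.aemeasurable _) ?_
  filter_upwards [hw.hasGradientAt] with t ht
  exact (continuous_iff_continuousAt.2 fun x => (ht x).continuousAt).comp c.continuous

theorem IsC11Integrand.integrable_comp (hw : IsC11Integrand w G a E)
    (c : C(I, EuclideanSpace ℝ (Fin d))) : Integrable fun t => w t (c t) := by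
  refine hw.integrable.mono' (hw.aemeasurable_comp c).aestronglyMeasurable ?_
  filter_upwards [hw.abs_le] with t ht using ht _

/-- No measurability of G is assumed: it is inherited from the difference quotients of w along c
with increments v/n. -/
theorem IsC11Integrand.aemeasurable_inner_grad (hw : IsC11Integrand w G a E)
    (c : C(I, EuclideanSpace ℝ (Fin d))) (v : EuclideanSpace ℝ (Fin d)) :
    AEMeasurable fun t => ⟪v, G t (c t)⟫ := by
  have h1 (n : ℕ) : AEMeasurable fun t =>
      (n : ℝ) • (w t (c t + (n : ℝ)⁻¹ • v) - w t (c t)) :=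
    ((hw.aemeasurable_comp (c + ContinuousMap.const I ((n : ℝ)⁻¹ • v))).sub
      (hw.aemeasurable_comp c)).const_smul (n : ℝ)
  refine aemeasurable_of_tendsto_metrizable_ae atTop h1 ?_
  filter_upwards [hw.hasGradientAt] with t ht
  have h2 := (ht (c t)).hasFDerivAt.lim v (tendsto_norm_atTop_atTop.comp
    (tendsto_natCast_atTop_atTop (R := ℝ)))
  rw [real_inner_comm]
  exact h2

theorem IsC11Integrand.aestronglyMeasurable_grad (hw : IsC11Integrand w G a E)
    (c : C(I, EuclideanSpace ℝ (Fin d))) : AEStronglyMeasurable fun t => G t (c t) := by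
  have h : AEStronglyMeasurable fun t : I => ∑ j, ⟪EuclideanSpace.basisFun (Fin d) ℝ j,
      G t (c t)⟫ • EuclideanSpace.basisFun (Fin d) ℝ j :=
    Finset.aestronglyMeasurable_fun_sum _ fun j _ =>
      (hw.aemeasurable_inner_grad c _).aestronglyMeasurable.smul_const _
  exact h.congr (ae_of_all _ fun t => (EuclideanSpace.basisFun (Fin d) ℝ).sum_repr' (G t (c t)))

theorem IsC11Integrand.integrable_grad (hw : IsC11Integrand w G a E)
    (c : C(I, EuclideanSpace ℝ (Fin d))) : Integrable fun t => G t (c t) := by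
  refine hw.integrable.mono' (hw.aestronglyMeasurable_grad c) ?_
  filter_upwards [hw.norm_grad_le] with t ht using ht _

theorem integrable_inner_continuousMap {g : I → EuclideanSpace ℝ (Fin d)} (hg : Integrable g)
    (η : C(I, EuclideanSpace ℝ (Fin d))) : Integrable fun t => ⟪g t, η t⟫ := by
  refine (hg.norm.mul_const ‖η‖).mono'
    (hg.aestronglyMeasurable.inner η.continuous.aestronglyMeasurable) (ae_of_all _ fun t => ?_)
  exact (norm_inner_le_norm _ _).trans
    (mul_le_mul_of_nonneg_left (η.norm_coe_le_norm t) (norm_nonneg _))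

open Classical in
/-- The functional `η ↦ ∫ ⟪g t, η t⟫ dt` on continuous curves, for integrable `g`. -/
def innerFunctional (g : I → EuclideanSpace ℝ (Fin d)) : C(I, EuclideanSpace ℝ (Fin d)) →L[ℝ] ℝ :=
  if hg : Integrable g then
    LinearMap.mkContinuous
      { toFun := fun η => ∫ t, ⟪g t, η t⟫
        map_add' := fun η ζ => by
          simp only [ContinuousMap.add_apply, inner_add_right]
          exact integral_add (integrable_inner_continuousMap hg η)
            (integrable_inner_continuousMap hg ζ)
        map_smul' := fun c η => by
          simp only [ContinuousMap.smul_apply, real_inner_smul_right]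
          exact integral_const_mul _ _ }
      (∫ t, ‖g t‖) fun η => by
        rw [← integral_mul_const]
        refine norm_integral_le_of_norm_le (hg.norm.mul_const _) (ae_of_all _ fun t => ?_)
        exact (norm_inner_le_norm _ _).trans
          (mul_le_mul_of_nonneg_left (η.norm_coe_le_norm t) (norm_nonneg _))
  else 0

theorem innerFunctional_apply {g : I → EuclideanSpace ℝ (Fin d)} (hg : Integrable g)
    (η : C(I, EuclideanSpace ℝ (Fin d))) : innerFunctional g η = ∫ t, ⟪g t, η t⟫ := by
  rw [innerFunctional, dif_pos hg]
  rfl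

theorem norm_innerFunctional_le {g : I → EuclideanSpace ℝ (Fin d)} (hg : Integrable g)
    {b : I → ℝ} (hb : Integrable b) (h : ∀ᵐ t : I, ‖g t‖ ≤ b t) :
    ‖innerFunctional g‖ ≤ ∫ t, b t := by
  have h1 : ∫ t, ‖g t‖ ≤ ∫ t, b t := integral_mono_ae hg.norm hb h
  rw [innerFunctional, dif_pos hg]
  exact (LinearMap.mkContinuous_norm_le _ (integral_nonneg fun t => norm_nonneg _) _).trans h1

theorem innerFunctional_sub {g h : I → EuclideanSpace ℝ (Fin d)} (hg : Integrable g)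
    (hh : Integrable h) :
    innerFunctional g - innerFunctional h = innerFunctional fun t => g t - h t := by
  ext η
  rw [sub_apply, innerFunctional_apply hg, innerFunctional_apply hh,
    innerFunctional_apply (g := fun t => g t - h t) (hg.sub hh), ← integral_sub (integrable_inner_continuousMap hg η)
    (integrable_inner_continuousMap hh η)]
  simp_rw [inner_sub_left]

/-- Mean value inequality on the ball around x of radius ‖y - x‖, where the gradient deviates from G
t x by at most a t ‖y - x‖. The sharp factor ½ is not needed. -/
theorem IsC11Integrand.taylor (hw : IsC11Integrand w G a E) :
    ∀ᵐ t : I, ∀ x y, |w t y - w t x - ⟪G t x, y - x⟫| ≤ a t * ‖y - x‖ ^ 2 := by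
  filter_upwards [hw.hasGradientAt, hw.norm_grad_sub_le, hw.ae_nonneg] with t h1 h2 h3 x y
  have := (convex_closedBall x ‖y - x‖).norm_image_sub_le_of_norm_hasFDerivWithin_le'
    (f := w t) (f' := fun z => InnerProductSpace.toDual ℝ _ (G t z))
    (φ := InnerProductSpace.toDual ℝ _ (G t x)) (C := a t * ‖y - x‖)
    (fun z _ => (h1 z).hasFDerivAt.hasFDerivWithinAt) (fun z hz => ?_)
    (Metric.mem_closedBall_self (norm_nonneg _)) (y := y) (by simp [dist_eq_norm])
  · rw [Real.norm_eq_abs, InnerProductSpace.toDual_apply_apply] at this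
    rwa [sq, ← mul_assoc]
  · rw [← map_sub, LinearIsometryEquiv.norm_map]
    exact (h2 z x).trans (mul_le_mul_of_nonneg_left (by simpa [dist_eq_norm] using hz) h3)

/-- Integrating the pointwise Taylor bound leaves a remainder of at most (∫a) ‖c' - c‖² in the sup
norm. -/
theorem IsC11Integrand.hasFDerivAt (hw : IsC11Integrand w G a E)
    (c : C(I, EuclideanSpace ℝ (Fin d))) :
    HasFDerivAt (fun c : C(I, EuclideanSpace ℝ (Fin d)) => ∫ t, w t (c t))
      (innerFunctional fun t => G t (c t)) c := by
  refine HasFDerivAt.of_isLittleO ((IsBigO.of_bound (∫ t, a t)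
    (Eventually.of_forall fun c' => ?_)).trans_isLittleO
    (isLittleO_pow_sub_sub c one_lt_two))
  rw [innerFunctional_apply (hw.integrable_grad c),
    ← integral_sub (hw.integrable_comp c') (hw.integrable_comp c),
    ← integral_sub (f := fun t => w t (c' t) - w t (c t))
      ((hw.integrable_comp c').sub (hw.integrable_comp c))
    (integrable_inner_continuousMap (hw.integrable_grad c) (c' - c)), ← integral_mul_const]
  refine norm_integral_le_of_norm_le (hw.integrable.mul_const _) ?_
  filter_upwards [hw.taylor, hw.ae_nonneg] with t ht ha
  refine (ht (c t) (c' t)).trans (mul_le_mul_of_nonneg_left ?_ ha)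
  rw [norm_pow, norm_norm]
  exact pow_le_pow_left₀ (norm_nonneg _) ((c' - c).norm_coe_le_norm t) 2

end Integrand

/-! ### Differentiability of the insertion functional -/

section Functional

variable {d : ℕ} {w : I → EuclideanSpace ℝ (Fin d) → ℝ}
  {G : I → EuclideanSpace ℝ (Fin d) → EuclideanSpace ℝ (Fin d)} {a : I → ℝ}
  {E : Set (EuclideanSpace ℝ (Fin d))} {α β : ℝ}

/-- The derivative of `W`. -/
def derivW (G : I → EuclideanSpace ℝ (Fin d) → EuclideanSpace ℝ (Fin d)) (γ : H1 d) :
    H1 d →L[ℝ] ℝ :=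
  -(innerFunctional fun t => G t (γ.curve t)).comp (H1.curveL d)

/-- The derivative of `½ ∫ |γ'|²`. -/
def derivEnergy (γ : H1 d) : H1 d →L[ℝ] ℝ :=
  (innerSL ℝ γ.deriv).comp (H1.derivL d)

/-- The derivative of `F = W / L`. -/
def derivF (w : I → EuclideanSpace ℝ (Fin d) → ℝ)
    (G : I → EuclideanSpace ℝ (Fin d) → EuclideanSpace ℝ (Fin d)) (α β : ℝ) (γ : H1 d) :
    H1 d →L[ℝ] ℝ :=
  (functionalL α β γ)⁻¹ • derivW G γ -
    (functionalW w γ * ((functionalL α β γ)⁻¹ * (functionalL α β γ)⁻¹)) • (β • derivEnergy γ)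

theorem integral_norm_sq_deriv (γ : H1 d) : ∫ t, ‖γ.deriv t‖ ^ 2 = ‖γ.deriv‖ ^ 2 := by
  rw [← real_inner_self_eq_norm_sq γ.deriv, L2.inner_def]
  simp_rw [real_inner_self_eq_norm_sq]

theorem functionalL_eq (α β : ℝ) (γ : H1 d) :
    functionalL α β γ = β / 2 * ‖γ.deriv‖ ^ 2 + α := by
  rw [functionalL, integral_norm_sq_deriv]

theorem le_functionalL (α : ℝ) (hβ : 0 < β) (γ : H1 d) : α ≤ functionalL α β γ := by
  rw [functionalL_eq]
  have : 0 ≤ β / 2 * ‖γ.deriv‖ ^ 2 := by positivity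
  linarith

theorem hasFDerivAt_functionalL (α β : ℝ) (γ : H1 d) :
    HasFDerivAt (functionalL (d := d) α β) (β • derivEnergy γ) γ := by
  have h := (((H1.derivL d).hasFDerivAt (x := γ)).norm_sq.const_mul (β / 2)).add_const α
  have h1 : functionalL (d := d) α β = fun γ => β / 2 * ‖H1.derivL d γ‖ ^ 2 + α := by
    funext γ
    rw [functionalL_eq, H1.derivL_apply]
  rw [h1]
  convert! h using 1
  ext η
  simp [derivEnergy, H1.derivL_apply]
  ring

theorem IsC11Integrand.hasFDerivAt_functionalW (hw : IsC11Integrand w G a E) (γ : H1 d) :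
    HasFDerivAt (functionalW (d := d) w) (derivW G γ) γ :=
  ((hw.hasFDerivAt γ.curve).comp γ ((H1.curveL d).hasFDerivAt (x := γ))).neg

theorem IsC11Integrand.hasFDerivAt_functionalF (hw : IsC11Integrand w G a E) (hα : 0 < α)
    (hβ : 0 < β) (γ : H1 d) :
    HasFDerivAt (functionalF (d := d) w α β) (derivF w G α β γ) γ := by
  have hL : functionalL α β γ ≠ 0 := (hα.trans_le (le_functionalL α hβ γ)).ne'
  have h := (hw.hasFDerivAt_functionalW γ).mul
    ((hasDerivAt_inv hL).comp_hasFDerivAt γ (hasFDerivAt_functionalL α β γ))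
  have h1 : functionalF (d := d) w α β =
      functionalW w * ((fun x => x⁻¹) ∘ functionalL α β) := by
    funext γ
    simp [functionalF, div_eq_mul_inv]
  rw [h1]
  convert! h using 1
  ext η
  simp [derivF, pow_two]
  ring

theorem IsC11Integrand.abs_functionalW_le (hw : IsC11Integrand w G a E) (γ : H1 d) :
    |functionalW w γ| ≤ ∫ t, a t := by
  rw [functionalW, abs_neg, ← Real.norm_eq_abs]
  refine norm_integral_le_of_norm_le hw.integrable ?_
  filter_upwards [hw.abs_le] with t ht using ht _

theorem norm_curveL_le : ‖H1.curveL d‖ ≤ 2 :=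
  ContinuousLinearMap.opNorm_le_bound _ zero_le_two fun γ => γ.norm_curve_le_two_mul

theorem norm_derivL_le : ‖H1.derivL d‖ ≤ 1 :=
  ContinuousLinearMap.opNorm_le_bound _ zero_le_one fun γ => by
    rw [one_mul]; exact γ.norm_deriv_le

theorem IsC11Integrand.norm_derivW_le (hw : IsC11Integrand w G a E) (γ : H1 d) :
    ‖derivW G γ‖ ≤ (∫ t, a t) * 2 := by
  refine (norm_neg (E := H1 d →L[ℝ] ℝ) _).trans_le ?_
  refine (ContinuousLinearMap.opNorm_comp_le _ _).trans (mul_le_mul ?_ norm_curveL_le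
    (norm_nonneg _) hw.integral_nonneg)
  refine norm_innerFunctional_le (hw.integrable_grad _) hw.integrable ?_
  filter_upwards [hw.norm_grad_le] with t ht using ht _

theorem IsC11Integrand.bddLipOn_derivW (hw : IsC11Integrand w G a E) (s : Set (H1 d)) :
    BddLipOn (derivW G) s := by
  -- Each factor 2 is the constant of the embedding of H¹ into continuous curves: once for the
  -- distance between γ and η, once for the test curve.
  refine .of_bounds (K := (∫ t, a t) * 2 * 2) (fun γ _ => hw.norm_derivW_le γ) fun γ _ η _ => ?_
  rw [derivW, derivW, neg_sub_neg, ← ContinuousLinearMap.sub_comp,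
    innerFunctional_sub (hw.integrable_grad _) (hw.integrable_grad _)]
  have h1 : ‖innerFunctional fun t => G t (η.curve t) - G t (γ.curve t)‖ ≤
      (∫ t, a t) * (2 * ‖γ - η‖) := by
    rw [← integral_mul_const]
    refine norm_innerFunctional_le ((hw.integrable_grad _).sub (hw.integrable_grad _))
      (hw.integrable.mul_const _) ?_
    filter_upwards [hw.norm_grad_sub_le, hw.ae_nonneg] with t ht ha
    refine (ht _ _).trans (mul_le_mul_of_nonneg_left ?_ ha)
    rw [norm_sub_rev]
    exact ((γ - η).curve.norm_coe_le_norm t).trans (γ - η).norm_curve_le_two_mul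
  have h2 := hw.integral_nonneg
  calc _ ≤ _ := ContinuousLinearMap.opNorm_comp_le _ _
    _ ≤ (∫ t, a t) * (2 * ‖γ - η‖) * 2 :=
      mul_le_mul h1 norm_curveL_le (norm_nonneg _) (by positivity)
    _ = _ := by ring

theorem bddLipOn_derivEnergy (R : ℝ) :
    BddLipOn (derivEnergy (d := d)) (Metric.closedBall 0 R) := by
  refine .of_bounds (M := R * 1) (K := 1 * 1) (fun γ hγ => ?_) fun γ _ η _ => ?_
  · refine (ContinuousLinearMap.opNorm_comp_le _ _).trans ?_
    have h1 : ‖γ‖ ≤ R := by simpa using hγ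
    rw [innerSL_apply_norm]
    exact mul_le_mul (γ.norm_deriv_le.trans h1) norm_derivL_le (norm_nonneg _)
      ((norm_nonneg _).trans h1)
  · rw [derivEnergy, derivEnergy, ← ContinuousLinearMap.sub_comp, ← map_sub]
    refine (ContinuousLinearMap.opNorm_comp_le _ _).trans ?_
    rw [innerSL_apply_norm, mul_right_comm]
    refine mul_le_mul ?_ norm_derivL_le (norm_nonneg _) (by positivity)
    rw [one_mul]
    exact (γ - η).norm_deriv_le

theorem IsC11Integrand.bddLipOn_functionalW (hw : IsC11Integrand w G a E) (R : ℝ) :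
    BddLipOn (functionalW (d := d) w) (Metric.closedBall 0 R) := by
  refine .of_bounds (K := (∫ t, a t) * 2) (fun γ _ => hw.abs_functionalW_le γ) fun γ hγ η hη => ?_
  exact (convex_closedBall _ _).norm_image_sub_le_of_norm_hasFDerivWithin_le
    (fun ζ _ => (hw.hasFDerivAt_functionalW ζ).hasFDerivWithinAt)
    (fun ζ _ => hw.norm_derivW_le ζ) hη hγ

theorem bddLipOn_functionalL (α β R : ℝ) :
    BddLipOn (functionalL (d := d) α β) (Metric.closedBall 0 R) := by
  obtain ⟨M, hM0, hM, -⟩ := (bddLipOn_const β _).smul (bddLipOn_derivEnergy (d := d) R)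
  refine .of_bounds (M := |β / 2| * R ^ 2 + |α|) (K := M) (fun γ hγ => ?_) fun γ hγ η hη => ?_
  · have h1 : ‖γ‖ ≤ R := by simpa using hγ
    rw [functionalL_eq]
    refine (norm_add_le _ _).trans (add_le_add ?_ le_rfl)
    rw [norm_mul, norm_pow, norm_norm]
    gcongr
    · exact le_rfl
    · exact γ.norm_deriv_le.trans h1
  · exact (convex_closedBall _ _).norm_image_sub_le_of_norm_hasFDerivWithin_le
      (fun ζ _ => (hasFDerivAt_functionalL α β ζ).hasFDerivWithinAt) hM hη hγ

/-- The quotient rule builds F' from bounded Lipschitz pieces by products and differences; L ≥ α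
handles the inverse. The restriction to balls comes from L and the energy derivative, which are
unbounded on H¹. -/
theorem IsC11Integrand.bddLipOn_derivF (hw : IsC11Integrand w G a E) (hα : 0 < α)
    (hβ : 0 < β) (R : ℝ) : BddLipOn (derivF (d := d) w G α β) (Metric.closedBall 0 R) := by
  have hinv := (bddLipOn_functionalL (d := d) α β R).inv hα fun γ _ => le_functionalL α hβ γ
  exact (hinv.smul (hw.bddLipOn_derivW _)).sub
    (((hw.bddLipOn_functionalW R).smul (hinv.smul hinv)).smul
      ((bddLipOn_const β _).smul (bddLipOn_derivEnergy R)))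

theorem IsC11Integrand.fderiv_functionalF (hw : IsC11Integrand w G a E) (hα : 0 < α)
    (hβ : 0 < β) : fderiv ℝ (functionalF (d := d) w α β) = derivF w G α β :=
  funext fun γ => (hw.hasFDerivAt_functionalF hα hβ γ).fderiv

theorem BddLipOn.continuousOn {E X : Type*} [SeminormedAddCommGroup E] [SeminormedAddCommGroup X]
    {f : E → X} {s : Set E} (hf : BddLipOn f s) : ContinuousOn f s := by
  obtain ⟨M, hM0, -, hM⟩ := hf
  refine (LipschitzOnWith.of_dist_le_mul (K := ⟨M, hM0⟩) fun x hx y hy => ?_).continuousOn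
  rw [dist_eq_norm, dist_eq_norm]
  exact hM x hx y hy

theorem IsC11Integrand.contDiff_functionalF (hw : IsC11Integrand w G a E) (hα : 0 < α)
    (hβ : 0 < β) : ContDiff ℝ 1 (functionalF (d := d) w α β) := by
  rw [contDiff_one_iff_fderiv]
  refine ⟨fun γ => (hw.hasFDerivAt_functionalF hα hβ γ).differentiableAt, ?_⟩
  rw [hw.fderiv_functionalF hα hβ]
  refine continuous_iff_continuousAt.2 fun γ => ?_
  refine (hw.bddLipOn_derivF hα hβ (‖γ‖ + 1)).continuousOn.continuousAt ?_
  exact Metric.closedBall_mem_nhds_of_mem (by simp)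

end Functional

/-! ### Gradient descent with Armijo-type step sizes -/

section Descent

variable {V : Type*} [NormedAddCommGroup V] [InnerProductSpace ℝ V] [CompleteSpace V] {F : V → ℝ}

theorem norm_gradient (F : V → ℝ) (x : V) : ‖gradient F x‖ = ‖fderiv ℝ F x‖ :=
  (InnerProductSpace.toDual ℝ V).symm.norm_map _

/-- Second order upper bound for the change of `F` along a gradient step. -/
theorem abs_gradient_step_le (hF : Differentiable ℝ F) {K : ℝ} {x : V} {δ : ℝ} (hδ : 0 ≤ δ)
    (hK : ∀ z ∈ Metric.closedBall x (δ * ‖gradient F x‖),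
      ‖fderiv ℝ F z - fderiv ℝ F x‖ ≤ K * ‖z - x‖) (hK0 : 0 ≤ K) :
    |F (x - δ • gradient F x) - F x + δ * ‖gradient F x‖ ^ 2| ≤
      K * (δ * ‖gradient F x‖) ^ 2 := by
  set g := gradient F x with hg
  have hn : ‖x - δ • g - x‖ = δ * ‖g‖ := by
    rw [sub_sub_cancel_left, norm_neg, norm_smul, Real.norm_of_nonneg hδ]
  have := (convex_closedBall x (δ * ‖g‖)).norm_image_sub_le_of_norm_hasFDerivWithin_le'
    (f := F) (f' := fderiv ℝ F) (φ := fderiv ℝ F x) (C := K * (δ * ‖g‖))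
    (fun z _ => (hF z).hasFDerivAt.hasFDerivWithinAt)
    (fun z hz => (hK z hz).trans (mul_le_mul_of_nonneg_left
      (by simpa [dist_eq_norm] using hz) hK0))
    (Metric.mem_closedBall_self (by positivity)) (y := x - δ • g)
    (by rw [Metric.mem_closedBall, dist_eq_norm, hn])
  have h1 : fderiv ℝ F x (x - δ • g - x) = -(δ * ‖g‖ ^ 2) := by
    rw [sub_sub_cancel_left, map_neg, map_smul, ← real_inner_self_eq_norm_sq, smul_eq_mul,
      ← InnerProductSpace.toDual_apply_apply (𝕜 := ℝ), hg, gradient,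
      LinearIsometryEquiv.apply_symm_apply]
  rw [h1, hn, Real.norm_eq_abs, sub_neg_eq_add] at this
  linarith

/-- Sequences with sufficient decrease whose steps are comparable to a fixed step or to a step with
insufficient decrease have vanishing gradients. -/
theorem tendsto_gradient_zero (hF : Differentiable ℝ F) {A R : ℝ} (hA : ∀ x, A ≤ F x)
    (hlip : ∃ K, 0 ≤ K ∧ ∀ x ∈ Metric.closedBall (0 : V) (R + 1),
      ∀ y ∈ Metric.closedBall (0 : V) (R + 1), ‖fderiv ℝ F x - fderiv ℝ F y‖ ≤ K * ‖x - y‖)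
    {x : ℕ → V} (hx : ∀ n, ‖x n‖ ≤ R) {δ : ℕ → ℝ} (hδ : ∀ n, 0 < δ n) {c : ℝ} (hc : 0 < c)
    (hdec : ∀ n, F (x (n + 1)) ≤ F (x n) - c * δ n * ‖gradient F (x n)‖ ^ 2)
    {κ τ δ₀ : ℝ} (hκ : κ < 1) (hτ : 0 < τ) (hδ₀ : 0 < δ₀)
    (hstep : ∀ n, δ₀ ≤ δ n ∨ ∃ δ', 0 < δ' ∧ τ * δ' ≤ δ n ∧
      F (x n) - κ * δ' * ‖gradient F (x n)‖ ^ 2 ≤ F (x n - δ' • gradient F (x n))) :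
    Tendsto (fun n => gradient F (x n)) atTop (𝓝 0) := by
  obtain ⟨K, hK0, hK⟩ := hlip
  -- By sufficient decrease c · s n is at most a difference of consecutive terms of a convergent
  -- sequence, so s tends to 0. It remains to bound the gradient by quantities vanishing with s.
  set s : ℕ → ℝ := fun n => δ n * ‖gradient F (x n)‖ ^ 2 with hs
  have hs0 (n : ℕ) : 0 ≤ s n := mul_nonneg (hδ n).le (sq_nonneg _)
  have hanti : Antitone fun n => F (x n) := antitone_nat_of_succ_le fun n => by
    have := hdec n
    have := mul_nonneg hc.le (hs0 n)
    simp only [hs] at this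
    linarith
  have hlim := tendsto_atTop_ciInf hanti ⟨A, by rintro _ ⟨n, rfl⟩; exact hA _⟩
  have hs_lim : Tendsto s atTop (𝓝 0) := by
    have h1 := (hlim.sub (hlim.comp (tendsto_add_atTop_nat 1))).div_const c
    rw [sub_self, zero_div] at h1
    refine squeeze_zero hs0 (fun n => ?_) h1
    rw [le_div_iff₀ hc]
    have := hdec n
    simp only [hs, Function.comp_apply]
    linarith
  -- The three nonnegative summands serve three cases: a long trial displacement, a step bounded
  -- below, and a short trial displacement.
  have hkey (n : ℕ) : ‖gradient F (x n)‖ ≤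
      s n / τ + √(s n / δ₀) + √(K * s n / (τ * (1 - κ))) := by
    have hκ' : 0 < 1 - κ := by linarith
    have hp1 : 0 ≤ s n / τ := div_nonneg (hs0 n) hτ.le
    have hp2 := Real.sqrt_nonneg (s n / δ₀)
    have hp3 := Real.sqrt_nonneg (K * s n / (τ * (1 - κ)))
    rcases hstep n with h | ⟨δ', hδ', hτδ, h⟩
    · have : ‖gradient F (x n)‖ ≤ √(s n / δ₀) := by
        refine Real.le_sqrt_of_sq_le ?_
        rw [le_div_iff₀ hδ₀, mul_comm]
        exact mul_le_mul_of_nonneg_right h (sq_nonneg _)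
      linarith
    -- A trial displacement of length at most 1 stays in the ball of radius R + 1, where F' is
    -- Lipschitz.
    · by_cases h1 : δ' * ‖gradient F (x n)‖ ≤ 1
      · have : ‖gradient F (x n)‖ ≤ √(K * s n / (τ * (1 - κ))) := by
          refine Real.le_sqrt_of_sq_le ?_
          rw [le_div_iff₀ (by positivity)]
          have hxR : x n ∈ Metric.closedBall (0 : V) (R + 1) := by
            simpa using (hx n).trans (by linarith)
          have h2 := (abs_le.1 (abs_gradient_step_le hF hδ'.le (fun z hz => hK z ?_ _ hxR) hK0)).2
          -- The trial step decreases F by at most κ δ' ‖∇F‖², while the expansion predicts δ' ‖∇F‖²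
          -- up to K δ'² ‖∇F‖². Comparing and dividing by δ' gives the bound.
          · have h3 : (1 - κ) * ‖gradient F (x n)‖ ^ 2 ≤
                K * (δ' * ‖gradient F (x n)‖ ^ 2) := by
              refine le_of_mul_le_mul_left ?_ hδ'
              nlinarith
            have h4 : τ * δ' * ‖gradient F (x n)‖ ^ 2 ≤ s n :=
              mul_le_mul_of_nonneg_right hτδ (sq_nonneg _)
            have h5 := mul_le_mul_of_nonneg_left h3 hτ.le
            have h6 := mul_le_mul_of_nonneg_left h4 hK0
            linarith
          · have h3 := norm_le_norm_add_norm_sub (x n) z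
            have h4 : ‖x n - z‖ ≤ δ' * ‖gradient F (x n)‖ := by
              rw [norm_sub_rev]; simpa [dist_eq_norm] using hz
            have := hx n
            simp only [Metric.mem_closedBall, dist_zero_right]
            linarith
        linarith
      · have : ‖gradient F (x n)‖ ≤ s n / τ := by
          rw [le_div_iff₀ hτ]
          have h2 : τ * δ' * ‖gradient F (x n)‖ ^ 2 ≤ s n :=
            mul_le_mul_of_nonneg_right hτδ (sq_nonneg _)
          have h3 : 0 ≤ τ * ‖gradient F (x n)‖ * (δ' * ‖gradient F (x n)‖ - 1) :=
            mul_nonneg (by positivity) (by linarith)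
          nlinarith
        linarith
  refine squeeze_zero_norm hkey ?_
  have h1 := (hs_lim.div_const δ₀).sqrt
  have h2 := ((hs_lim.const_mul K).div_const (τ * (1 - κ))).sqrt
  have h3 := ((hs_lim.div_const τ).add h1).add h2
  simpa using h3

theorem IsDescentSequence.le_initial {x : ℕ → V} (hx : IsDescentSequence F x) (n : ℕ) :
    F (x n) ≤ F (x 0) := by
  obtain ⟨-, δ, hstep, hrule⟩ := hx
  have : Antitone fun n => F (x n) := antitone_nat_of_succ_le fun n => by
    rw [hstep n]
    rcases hrule with ⟨c₁, c₂, hc₁, -, -, h⟩ | ⟨δ₀, τ, c, hδ₀, hτ, -, hc, -, h⟩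
    · obtain ⟨h1, h2, -⟩ := h n
      have : 0 ≤ c₁ * δ n * ‖gradient F (x n)‖ ^ 2 := by positivity
      unfold SufficientDecrease at h2
      linarith
    · obtain ⟨k, h1, h2, -⟩ := h n
      have : 0 < δ n := by rw [h1]; positivity
      have : 0 ≤ c * δ n * ‖gradient F (x n)‖ ^ 2 := by positivity
      unfold SufficientDecrease at h2
      linarith
  exact this (Nat.zero_le n)

theorem IsDescentSequence.tendsto_gradient (hF : Differentiable ℝ F) {A R : ℝ}
    (hA : ∀ x, A ≤ F x)
    (hlip : ∃ K, 0 ≤ K ∧ ∀ x ∈ Metric.closedBall (0 : V) (R + 1),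
      ∀ y ∈ Metric.closedBall (0 : V) (R + 1), ‖fderiv ℝ F x - fderiv ℝ F y‖ ≤ K * ‖x - y‖)
    {x : ℕ → V} (hx : IsDescentSequence F x) (hxR : ∀ n, ‖x n‖ ≤ R) :
    Tendsto (fun n => gradient F (x n)) atTop (𝓝 0) := by
  obtain ⟨-, δ, hstep, hrule⟩ := hx
  rcases hrule with ⟨c₁, c₂, hc₁, -, hc₂, h⟩ | ⟨δ₀, τ, c, hδ₀, hτ, -, hc, hc', h⟩
  -- The accepted step is its own trial step, with κ = c₂ and τ = 1; the fixed step 1 is a dummy, as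
  -- that alternative never occurs.
  · refine tendsto_gradient_zero hF hA hlip hxR (fun n => (h n).1) hc₁ (fun n => ?_) hc₂ one_pos
      one_pos fun n => Or.inr ⟨δ n, (h n).1, (one_mul _).le, (h n).2.2⟩
    rw [hstep n]
    exact (h n).2.1
  · have hδ (n : ℕ) : 0 < δ n := by
      obtain ⟨k, h1, -⟩ := h n
      rw [h1]; positivity
    refine tendsto_gradient_zero hF hA hlip hxR hδ hc (fun n => ?_) hc' hτ hδ₀ fun n => ?_
    · rw [hstep n]
      obtain ⟨k, -, h2, -⟩ := h n
      exact h2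
    · obtain ⟨k, h1, -, h3⟩ := h n
      -- Either the initial step was accepted, or the preceding trial step, larger by the factor
      -- 1/τ, was rejected.
      rcases k with _ | k
      · exact Or.inl (by simp [h1])
      · refine Or.inr ⟨τ ^ k * δ₀, by positivity, by rw [h1, pow_succ]; linarith, ?_⟩
        exact (not_le.1 (h3 k (Nat.lt_succ_self k))).le

end Descent

/-! ### Compactness of descent sequences -/

section Compactness

variable {d : ℕ}

/-- Cauchy–Schwarz: pairing v with the indicator of s times c = ∫_s v gives ‖c‖² ≤ √|s| ‖c‖ ‖v‖. -/
theorem norm_setIntegral_lp_le (v : Lp (EuclideanSpace ℝ (Fin d)) 2 (volume : Measure I))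
    {s : Set I} (hs : MeasurableSet s) : ‖∫ r in s, v r‖ ≤ √(volume.real s) * ‖v‖ := by
  set c := ∫ r in s, v r with hc
  have h1 := L2.inner_indicatorConstLp_eq_inner_setIntegral ℝ hs (measure_ne_top volume s) c v
  rw [← hc, real_inner_self_eq_norm_sq] at h1
  have h2 := real_inner_le_norm (indicatorConstLp 2 hs (measure_ne_top volume s) c) v
  rw [h1, norm_indicatorConstLp (by norm_num) (by norm_num)] at h2
  rw [Real.sqrt_eq_rpow]
  simp only [ENNReal.toReal_ofNat] at h2
  rcases (norm_nonneg c).eq_or_lt with h0 | h0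
  · rw [← h0]; positivity
  · refine le_of_mul_le_mul_left ?_ h0
    linarith

theorem H1.norm_curve_sub_le_sqrt (γ : H1 d) (s t : I) :
    ‖γ.curve t - γ.curve s‖ ≤ √(dist s t) * ‖γ.deriv‖ := by
  wlog hst : s ≤ t generalizing s t
  · rw [norm_sub_rev, dist_comm]
    exact this t s (le_of_not_ge hst)
  have hint := integrable_lp γ.deriv
  have h1 := setIntegral_union (μ := volume) (Set.Iic_disjoint_Ioc le_rfl) measurableSet_Ioc
    hint.integrableOn hint.integrableOn (s := Set.Iic s) (t := Set.Ioc s t)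
  rw [Set.Iic_union_Ioc_eq_Iic hst] at h1
  rw [γ.curve_eq t, γ.curve_eq s, h1, add_sub_add_left_eq_sub, add_sub_cancel_left]
  have h2 := norm_setIntegral_lp_le γ.deriv (measurableSet_Ioc (a := s) (b := t))
  have h3 : (s : ℝ) ≤ t := hst
  rwa [measureReal_def, unitInterval.volume_Ioc, ENNReal.toReal_ofReal (by linarith),
    ← abs_of_nonneg (sub_nonneg.2 h3), ← Real.dist_eq, dist_comm, ← Subtype.dist_eq] at h2

/-- Bounded sequences in `H¹` have uniformly Cauchy subsequences. -/
theorem exists_cauchySeq_curve {x : ℕ → H1 d} {R : ℝ} (hx : ∀ n, ‖x n‖ ≤ R) :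
    ∃ k : ℕ → ℕ, StrictMono k ∧ CauchySeq fun n => (x (k n)).curve := by
  let b : ℕ → BoundedContinuousFunction I (EuclideanSpace ℝ (Fin d)) := fun n =>
    BoundedContinuousFunction.mkOfCompact (x n).curve
  have hcomp : IsCompact (closure (Set.range b)) := by
    refine BoundedContinuousFunction.arzela_ascoli _ (isCompact_closedBall 0 (2 * R)) _ ?_ ?_
    · rintro _ t ⟨n, rfl⟩
      rw [Metric.mem_closedBall, dist_zero_right]
      exact ((x n).curve.norm_coe_le_norm t).trans
        ((x n).norm_curve_le_two_mul.trans (by linarith [hx n]))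
    · refine Metric.equicontinuous_of_continuity_modulus (fun r => √r * R) ?_ _ ?_
      · have : Continuous fun r : ℝ => √r * R := by fun_prop
        simpa using this.tendsto 0
      · rintro s t ⟨_, n, rfl⟩
        rw [dist_comm, dist_eq_norm]
        exact ((x n).norm_curve_sub_le_sqrt s t).trans (mul_le_mul_of_nonneg_left
          ((x n).norm_deriv_le.trans (hx n)) (Real.sqrt_nonneg _))
  -- Only the Cauchy property is kept: the uniform limit need not be identified in H¹, whose
  -- completeness later supplies the limit.
  obtain ⟨c, -, k, hk, hlim⟩ := hcomp.tendsto_subseq fun n => subset_closure (Set.mem_range_self n)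
  refine ⟨k, hk, ?_⟩
  have := hlim.cauchySeq
  rw [cauchySeq_iff_tendsto_dist_atTop_0] at this ⊢
  refine this.congr fun n => ?_
  exact BoundedContinuousFunction.dist_mkOfCompact _ _

variable {w : I → EuclideanSpace ℝ (Fin d) → ℝ}
  {G : I → EuclideanSpace ℝ (Fin d) → EuclideanSpace ℝ (Fin d)} {a : I → ℝ}
  {E : Set (EuclideanSpace ℝ (Fin d))} {α β : ℝ}

/-- The quotient rule multiplied by L, with W/L written as F. At negative levels the coefficient -βF
is positive, so this controls the derivative of γ. -/
theorem derivF_identity (w : I → EuclideanSpace ℝ (Fin d) → ℝ)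
    (G : I → EuclideanSpace ℝ (Fin d) → EuclideanSpace ℝ (Fin d)) (hα : 0 < α) (hβ : 0 < β)
    (γ η : H1 d) :
    -functionalF w α β γ * β * ⟪γ.deriv, η.deriv⟫ =
      functionalL α β γ * derivF w G α β γ η - derivW G γ η := by
  have hL : functionalL α β γ ≠ 0 := (hα.trans_le (le_functionalL α hβ γ)).ne'
  have h1 : derivF w G α β γ η = (functionalL α β γ)⁻¹ * derivW G γ η -
    (functionalW w γ * ((functionalL α β γ)⁻¹ * (functionalL α β γ)⁻¹)) *
      (β * ⟪γ.deriv, η.deriv⟫) := rfl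
  rw [h1, functionalF]
  field_simp
  ring

/-- The sup norm on the right, rather than the H¹ norm, is what lets Arzelà–Ascoli absorb this term.
-/
theorem IsC11Integrand.abs_derivW_le (hw : IsC11Integrand w G a E) (γ η : H1 d) :
    |derivW G γ η| ≤ (∫ t, a t) * ‖η.curve‖ := by
  have h1 : derivW G γ η = -innerFunctional (fun t => G t (γ.curve t)) η.curve := rfl
  rw [h1, abs_neg, ← Real.norm_eq_abs]
  refine ContinuousLinearMap.le_of_opNorm_le _ ?_ _
  refine norm_innerFunctional_le (hw.integrable_grad _) hw.integrable ?_
  filter_upwards [hw.norm_grad_le] with t ht using ht _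

theorem IsC11Integrand.exists_curve_mem (hw : IsC11Integrand w G a E) {γ : H1 d}
    (hγ : functionalF w α β γ ≠ 0) : ∃ t, γ.curve t ∈ E := by
  by_contra! h
  refine hγ ?_
  have : ∫ t, w t (γ.curve t) = 0 := by
    refine integral_eq_zero_of_ae ?_
    filter_upwards [hw.eq_zero] with t ht using ht _ (h t)
  rw [functionalF, functionalW, this, neg_zero, zero_div]

theorem IsC11Integrand.neg_le_functionalF (hw : IsC11Integrand w G a E) (hα : 0 < α)
    (hβ : 0 < β) (γ : H1 d) : -((∫ t, a t) / α) ≤ functionalF w α β γ := by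
  have hL := le_functionalL α hβ γ
  have h1 := (_root_.abs_le.1 (hw.abs_functionalW_le γ)).1
  have h2 := hw.integral_nonneg
  rw [functionalF, ← neg_div, div_le_div_iff₀ hα (hα.trans_le hL)]
  nlinarith

/-- Since F = W/L, the level bound reads m L ≤ -W ≤ ∫a. -/
theorem IsC11Integrand.functionalL_le (hw : IsC11Integrand w G a E) (hα : 0 < α)
    (hβ : 0 < β) {m : ℝ} (hm : 0 < m) {γ : H1 d} (hγ : functionalF w α β γ ≤ -m) :
    functionalL α β γ ≤ (∫ t, a t) / m := by
  have hL := hα.trans_le (le_functionalL α hβ γ)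
  have h1 := (_root_.abs_le.1 (hw.abs_functionalW_le γ)).1
  rw [functionalF, div_le_iff₀ hL] at hγ
  rw [le_div_iff₀ hm]
  linarith

/-- Sublevel sets of `F` at negative levels are bounded. -/
theorem IsC11Integrand.exists_norm_le (hw : IsC11Integrand w G a E) (hα : 0 < α) (hβ : 0 < β)
    (hE : Bornology.IsBounded E) {m : ℝ} (hm : 0 < m) :
    ∃ R, ∀ γ : H1 d, functionalF w α β γ ≤ -m → ‖γ‖ ≤ R := by
  obtain ⟨r, hr⟩ := hE.exists_norm_le
  refine ⟨r + √((∫ t, a t) / m / (β / 2)) + √((∫ t, a t) / m / (β / 2)), fun γ hγ => ?_⟩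
  have h1 : ‖γ.deriv‖ ≤ √((∫ t, a t) / m / (β / 2)) := by
    refine Real.le_sqrt_of_sq_le ?_
    rw [le_div_iff₀ (by positivity)]
    have := hw.functionalL_le hα hβ hm hγ
    rw [functionalL_eq] at this
    linarith
  -- The energy alone does not see translations; a point of the curve in the bounded set E fixes its
  -- position.
  obtain ⟨t, ht⟩ := hw.exists_curve_mem (γ := γ) (α := α) (β := β) (by linarith)
  have h2 : ‖γ.curve‖ ≤ r + ‖γ.deriv‖ := by
    refine (ContinuousMap.norm_le_of_nonempty _).2 fun s => ?_
    have h3 := γ.norm_curve_sub_le t s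
    have h4 := norm_le_norm_add_norm_sub' (γ.curve s) (γ.curve t)
    linarith [hr _ ht]
  linarith [γ.norm_le_add]

/-- The identity is tested at γ and at ζ with the same η = γ - ζ. Each pairing is estimated
separately, as the coefficients F(γ) and F(ζ) differ. -/
theorem IsC11Integrand.norm_sq_deriv_sub_le (hw : IsC11Integrand w G a E) (hα : 0 < α)
    (hβ : 0 < β) {m : ℝ} (hm : 0 < m) {γ ζ : H1 d} (hγ : functionalF w α β γ ≤ -m)
    (hζ : functionalF w α β ζ ≤ -m) :
    m * β * ‖(γ - ζ).deriv‖ ^ 2 ≤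
      (∫ t, a t) / m * ((‖derivF w G α β γ‖ + ‖derivF w G α β ζ‖) * ‖γ - ζ‖) +
        2 * (∫ t, a t) * ‖γ.curve - ζ.curve‖ := by
  have key : ∀ ξ η : H1 d, functionalF w α β ξ ≤ -m → m * β * |⟪ξ.deriv, η.deriv⟫| ≤
      (∫ t, a t) / m * (‖derivF w G α β ξ‖ * ‖η‖) + (∫ t, a t) * ‖η.curve‖ := by
    intro ξ η hξ
    have hL := hα.trans_le (le_functionalL α hβ ξ)
    have h1 := derivF_identity w G hα hβ ξ η
    have h2 : |-functionalF w α β ξ * β * ⟪ξ.deriv, η.deriv⟫| =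
        -functionalF w α β ξ * β * |⟪ξ.deriv, η.deriv⟫| := by
      rw [abs_mul, abs_of_pos (mul_pos (by linarith) hβ)]
    have h3 : |functionalL α β ξ * derivF w G α β ξ η| ≤
        (∫ t, a t) / m * (‖derivF w G α β ξ‖ * ‖η‖) := by
      rw [abs_mul, abs_of_pos hL]
      exact mul_le_mul (hw.functionalL_le hα hβ hm hξ) ((derivF w G α β ξ).le_opNorm η)
        (abs_nonneg _) (div_nonneg hw.integral_nonneg hm.le)
    have h4 : m * β * |⟪ξ.deriv, η.deriv⟫| ≤
        -functionalF w α β ξ * β * |⟪ξ.deriv, η.deriv⟫| := by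
      gcongr
      linarith
    rw [← h2, h1] at h4
    exact h4.trans ((abs_sub _ _).trans (add_le_add h3 (hw.abs_derivW_le ξ η)))
  have h1 := key γ (γ - ζ) hγ
  have h2 := key ζ (γ - ζ) hζ
  have h3 : ‖(γ - ζ).deriv‖ ^ 2 = ⟪γ.deriv, (γ - ζ).deriv⟫ - ⟪ζ.deriv, (γ - ζ).deriv⟫ := by
    rw [← inner_sub_left, ← real_inner_self_eq_norm_sq]
    rfl
  have h4 : ‖(γ - ζ).deriv‖ ^ 2 ≤ |⟪γ.deriv, (γ - ζ).deriv⟫| + |⟪ζ.deriv, (γ - ζ).deriv⟫| := by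
    rw [h3]
    linarith [le_abs_self ⟪γ.deriv, (γ - ζ).deriv⟫, neg_abs_le ⟪ζ.deriv, (γ - ζ).deriv⟫]
  have h5 : (γ - ζ).curve = γ.curve - ζ.curve := rfl
  rw [h5] at h1 h2
  have h6 := mul_le_mul_of_nonneg_left h4 (mul_pos hm hβ).le
  linarith

/-- Palais-Smale condition: bounded sequences at negative levels with vanishing derivative have
convergent subsequences. -/
theorem IsC11Integrand.exists_tendsto_subseq (hw : IsC11Integrand w G a E) (hα : 0 < α)
    (hβ : 0 < β) {m R : ℝ} (hm : 0 < m) {x : ℕ → H1 d} (hx : ∀ n, functionalF w α β (x n) ≤ -m)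
    (hR : ∀ n, ‖x n‖ ≤ R) (hD : Tendsto (fun n => ‖derivF w G α β (x n)‖) atTop (𝓝 0)) :
    ∃ (y : H1 d) (k : ℕ → ℕ), StrictMono k ∧ Tendsto (x ∘ k) atTop (𝓝 y) := by
  obtain ⟨k, hk, hc⟩ := exists_cauchySeq_curve hR
  suffices h : CauchySeq (x ∘ k) by
    obtain ⟨y, hy⟩ := cauchySeq_tendsto_of_complete h
    exact ⟨y, k, hk, hy⟩
  rw [cauchySeq_iff_tendsto_dist_atTop_0] at hc ⊢
  have hD' := hD.comp hk.tendsto_atTop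
  have hfst : Tendsto (fun n : ℕ × ℕ => ‖derivF w G α β (x (k n.1))‖) atTop (𝓝 0) := by
    rw [← prod_atTop_atTop_eq]
    exact hD'.comp tendsto_fst
  have hsnd : Tendsto (fun n : ℕ × ℕ => ‖derivF w G α β (x (k n.2))‖) atTop (𝓝 0) := by
    rw [← prod_atTop_atTop_eq]
    exact hD'.comp tendsto_snd
  have hrhs := hc.add (((((hfst.add hsnd).mul_const (2 * R)).const_mul ((∫ t, a t) / m)).add
    (hc.const_mul (2 * ∫ t, a t))).div_const (m * β)).sqrt
  simp only [add_zero, zero_mul, mul_zero, zero_div, Real.sqrt_zero] at hrhs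
  refine squeeze_zero (fun _ => dist_nonneg) (fun n => ?_) hrhs
  set γ := x (k n.1) with hγ
  set ζ := x (k n.2) with hζ
  have h1 := hw.norm_sq_deriv_sub_le hα hβ hm (hx (k n.1)) (hx (k n.2))
  rw [← hγ, ← hζ] at h1
  have h2 : ‖γ - ζ‖ ≤ 2 * R := by
    refine (norm_sub_le _ _).trans ?_
    linarith [hR (k n.1), hR (k n.2)]
  have h3 := (γ - ζ).norm_le_add
  have h4 : (γ - ζ).curve = γ.curve - ζ.curve := rfl
  have h5 : 0 ≤ (∫ t, a t) / m := div_nonneg hw.integral_nonneg hm.le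
  change dist γ ζ ≤ _
  rw [dist_eq_norm, dist_eq_norm]
  rw [h4] at h3
  refine h3.trans (add_le_add le_rfl (Real.le_sqrt_of_sq_le ?_))
  rw [le_div_iff₀ (by positivity), mul_comm]
  refine h1.trans (add_le_add (mul_le_mul_of_nonneg_left (mul_le_mul_of_nonneg_left h2
    (by positivity)) h5) le_rfl)

end Compactness

/-! ### Chain rule for absolutely continuous functions -/

section ChainRule

theorem _root_.AbsolutelyContinuousOnInterval.comp_lipschitzOnWith {X Y : Type*} [PseudoMetricSpace X]
    [PseudoMetricSpace Y] {f : ℝ → X} {g : X → Y} {a b : ℝ} {K : ℝ≥0} {s : Set X}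
    (hf : AbsolutelyContinuousOnInterval f a b) (hg : LipschitzOnWith K g s)
    (hs : Set.MapsTo f (Set.uIcc a b) s) : AbsolutelyContinuousOnInterval (g ∘ f) a b := by
  rw [absolutelyContinuousOnInterval_iff] at hf ⊢
  intro ε hε
  -- K + 1 avoids dividing by a vanishing Lipschitz constant.
  obtain ⟨δ, hδ, h⟩ := hf (ε / (K + 1)) (by positivity)
  refine ⟨δ, hδ, fun P hP hPδ => ?_⟩
  have h1 := h P hP hPδ
  rw [lt_div_iff₀ (by positivity)] at h1
  refine lt_of_le_of_lt ?_ h1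
  rw [Finset.sum_mul]
  refine Finset.sum_le_sum fun j hj => ?_
  have hj' := hP.1 j hj
  refine (hg.dist_le_mul _ (hs hj'.1) _ (hs hj'.2)).trans ?_
  rw [mul_comm]
  exact mul_le_mul_of_nonneg_left (by linarith) dist_nonneg

/-- The primitive is absolutely continuous and bounded, and ψ is Lipschitz on its range. The
composition is then absolutely continuous, so the fundamental theorem of calculus applies with the
chain rule almost everywhere. -/
theorem intervalIntegral_comp_primitive {q : ℝ → ℝ} {b c : ℝ} (hq : IntervalIntegrable q volume 0 b)
    {ψ : ℝ → ℝ} (hψ : ContDiff ℝ 1 ψ) :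
    ψ (c + ∫ s in (0 : ℝ)..b, q s) = ψ c +
      ∫ s in (0 : ℝ)..b, deriv ψ (c + ∫ r in (0 : ℝ)..s, q r) * q s := by
  set u : ℝ → ℝ := fun s => c + ∫ r in (0 : ℝ)..s, q r with hu
  have hu_ac : AbsolutelyContinuousOnInterval u 0 b :=
    ((LipschitzWith.const c).lipschitzOnWith.absolutelyContinuousOnInterval).add
      (hq.absolutelyContinuousOnInterval_intervalIntegral Set.left_mem_uIcc)
  obtain ⟨M, hM⟩ := hu_ac.exists_bound
  obtain ⟨K, hK⟩ := hψ.contDiffOn.exists_lipschitzOnWith (s := Set.Icc (-M) M) one_ne_zero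
    (convex_Icc _ _) isCompact_Icc
  have hac := hu_ac.comp_lipschitzOnWith hK fun s hs => abs_le.1 (hM s hs)
  have h0 : u 0 = c := by simp [hu]
  have h1 := hac.integral_deriv_eq_sub
  have h2 : ∫ s in (0 : ℝ)..b, deriv (ψ ∘ u) s = ∫ s in (0 : ℝ)..b, deriv ψ (u s) * q s := by
    refine intervalIntegral.integral_congr_ae ?_
    filter_upwards [hq.ae_hasDerivAt_integral] with s hs hsb
    have h3 := (hs (Set.uIoc_subset_uIcc hsb) 0 Set.left_mem_uIcc).const_add c
    exact (((hψ.differentiable one_ne_zero) (u s)).hasDerivAt.comp s h3).deriv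
  rw [h2, Function.comp_apply, Function.comp_apply, h0] at h1
  rw [h1]
  ring

theorem setIntegral_Iic_unitInterval (g : ℝ → ℝ) (t : I) :
    ∫ s in Set.Iic t, g (s : ℝ) = ∫ s in (0 : ℝ)..t, g s := by
  have h := unitInterval.measurePreserving_coe.setIntegral_preimage_emb
    unitInterval.measurableEmbedding_coe g (Set.Iic (t : ℝ))
  have h1 : ((↑) : I → ℝ) ⁻¹' Set.Iic (t : ℝ) = Set.Iic t := rfl
  have h2 : Set.Iic (t : ℝ) ∩ I = Set.Icc 0 (t : ℝ) := by
    ext s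
    have := t.2.2
    simp only [Set.mem_inter_iff, Set.mem_Iic, Set.mem_Icc]
    exact ⟨fun h => ⟨h.2.1, h.1⟩, fun h => ⟨h.2, h.1, h.2.trans this⟩⟩
  rw [← h1, h, Measure.restrict_restrict measurableSet_Iic, h2,
    intervalIntegral.integral_of_le t.2.1, integral_Icc_eq_integral_Ioc]

theorem setIntegral_comp_primitive {q : I → ℝ} (hq : Integrable q) {c : ℝ} {ψ : ℝ → ℝ}
    (hψ : ContDiff ℝ 1 ψ) {u : I → ℝ} (hu : ∀ t, u t = c + ∫ s in Set.Iic t, q s) (t : I) :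
    ψ (u t) = ψ c + ∫ s in Set.Iic t, deriv ψ (u s) * q s := by
  -- Extension of q to the real line; only its values on [0,1] enter.
  set Q : ℝ → ℝ := fun s => q (Set.projIcc 0 1 zero_le_one s) with hQ
  have hQq (s : I) : Q s = q s := by simp [hQ]
  have hprim (s : I) : u s = c + ∫ r in (0 : ℝ)..s, Q r := by
    rw [hu s, ← setIntegral_Iic_unitInterval]
    simp_rw [hQq]
  have hQint : IntegrableOn Q (Set.Icc 0 1) := by
    have := (unitInterval.measurePreserving_coe.integrable_comp_emb
      unitInterval.measurableEmbedding_coe (g := Q)).1 (hq.congr (ae_of_all _ fun s => (hQq s).symm))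
    exact this
  have hQi : IntervalIntegrable Q volume 0 t := by
    rw [intervalIntegrable_iff_integrableOn_Icc_of_le t.2.1]
    exact hQint.mono_set (Set.Icc_subset_Icc_right t.2.2)
  rw [hprim t, intervalIntegral_comp_primitive hQi hψ, ← setIntegral_Iic_unitInterval]
  simp_rw [← hprim, hQq]

end ChainRule

/-! ### Critical points -/

section Critical

variable {d : ℕ} {w : I → EuclideanSpace ℝ (Fin d) → ℝ}
  {G : I → EuclideanSpace ℝ (Fin d) → EuclideanSpace ℝ (Fin d)} {a : I → ℝ}
  {E : Set (EuclideanSpace ℝ (Fin d))} {α β : ℝ}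

/-- For `γ ∈ H¹` and smooth `ψ`, the curve `t ↦ ψ(⟪v, γ(t)⟫ - c) v` lies in `H¹`. -/
theorem H1.exists_comp_inner (γ : H1 d) (v : EuclideanSpace ℝ (Fin d)) (c : ℝ) {ψ : ℝ → ℝ}
    (hψ : ContDiff ℝ 1 ψ) : ∃ η : H1 d,
      (∀ t, η.curve t = ψ (⟪v, γ.curve t⟫ - c) • v) ∧
      ∀ᵐ t : I, η.deriv t = (_root_.deriv ψ (⟪v, γ.curve t⟫ - c) * ⟪v, γ.deriv t⟫) • v := by
  set u : I → ℝ := fun t => ⟪v, γ.curve t⟫ - c with hu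
  have hu_cont : Continuous u := by fun_prop
  set q : I → ℝ := fun t => ⟪v, γ.deriv t⟫ with hq
  have hq_int : Integrable q := (integrable_lp γ.deriv).const_inner v
  have hu_eq (t : I) : u t = u 0 + ∫ s in Set.Iic t, q s := by
    rw [integral_inner (integrable_lp γ.deriv).integrableOn]
    simp only [hu]
    rw [γ.curve_eq t, inner_add_right]
    ring
  have hdψ : Continuous fun t => _root_.deriv ψ (u t) := (hψ.continuous_deriv le_rfl).comp hu_cont
  obtain ⟨C, hC⟩ := isCompact_univ.exists_bound_of_continuousOn hdψ.continuousOn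
  -- ψ' is bounded along the curve by compactness, so the candidate derivative is dominated by a
  -- multiple of the derivative of γ.
  have hmem : MemLp (fun t => (_root_.deriv ψ (u t) * q t) • v) 2 (volume : Measure I) := by
    refine (Lp.memLp γ.deriv).of_le_mul (c := C * ‖v‖ * ‖v‖)
      ((hdψ.aestronglyMeasurable.mul hq_int.aestronglyMeasurable).smul_const v)
      (ae_of_all _ fun t => ?_)
    rw [norm_smul, norm_mul]
    have h1 : ‖q t‖ ≤ ‖v‖ * ‖γ.deriv t‖ := norm_inner_le_norm _ _
    have h2 := mul_le_mul (hC t (Set.mem_univ t)) h1 (norm_nonneg _)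
      ((norm_nonneg _).trans (hC t (Set.mem_univ t)))
    have h3 := mul_le_mul_of_nonneg_right h2 (norm_nonneg v)
    linarith
  refine ⟨⟨(⟨fun t => ψ (u t) • v, by have := hψ.continuous; fun_prop⟩, hmem.toLp _), fun t => ?_⟩,
    fun t => rfl, hmem.coeFn_toLp⟩
  change ψ (u t) • v = ψ (u 0) • v + ∫ s in Set.Iic t, hmem.toLp _ s
  rw [integral_congr_ae (ae_restrict_of_ae hmem.coeFn_toLp), integral_smul_const, ← add_smul,
    setIntegral_comp_primitive hq_int hψ hu_eq t]

/-- Critical points of `F` at negative levels are curves in the convex set `E`. -/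
theorem IsC11Integrand.range_curve_subset (hw : IsC11Integrand w G a E) (hα : 0 < α)
    (hβ : 0 < β) (hE : IsClosed E) (hconv : Convex ℝ E) {γ : H1 d}
    (hγ : functionalF w α β γ < 0) (hcrit : derivF w G α β γ = 0) :
    Set.range γ.curve ⊆ E := by
  rintro _ ⟨t₀, rfl⟩
  by_contra ht₀
  obtain ⟨l, c, hlE, hl⟩ := geometric_hahn_banach_closed_point hconv hE ht₀
  set v := (InnerProductSpace.toDual ℝ _).symm l with hv
  have hlv (x : EuclideanSpace ℝ (Fin d)) : l x = ⟪v, x⟫ := by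
    rw [hv, InnerProductSpace.toDual_symm_apply]
  -- `expNegInvGlue` is smooth, nondecreasing, zero on (-∞, 0] and positive on (0, ∞), so η detects
  -- exactly the excursions beyond the separating hyperplane.
  obtain ⟨η, hη, hη'⟩ := γ.exists_comp_inner v c (expNegInvGlue.contDiff (n := 1))
  obtain ⟨t₁, ht₁⟩ := hw.exists_curve_mem hγ.ne
  have hzero (t : I) (ht : γ.curve t ∈ E) : η.curve t = 0 := by
    have := hlE _ ht
    rw [hlv] at this
    rw [hη t, expNegInvGlue.zero_of_nonpos (by linarith), zero_smul]
  -- For almost every time one factor vanishes: η when the curve is in E, the gradient of w when it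
  -- is not.
  have hW : derivW G γ η = 0 := by
    have h1 : derivW G γ η = -innerFunctional (fun t => G t (γ.curve t)) η.curve := rfl
    rw [h1, innerFunctional_apply (hw.integrable_grad _), neg_eq_zero]
    refine integral_eq_zero_of_ae ?_
    filter_upwards [hw.grad_eq_zero] with t ht
    by_cases h : γ.curve t ∈ E
    · simp [hzero t h]
    · simp [ht _ h]
  have horth : ⟪γ.deriv, η.deriv⟫ = 0 := by
    have h1 := derivF_identity w G hα hβ γ η
    rw [hcrit, hW, zero_apply, mul_zero, sub_zero] at h1
    exact (mul_eq_zero.1 h1).resolve_left (mul_ne_zero (by linarith) hβ.ne')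
  have hpt : ∀ᵐ t : I, ⟪γ.deriv t, η.deriv t⟫ =
      deriv expNegInvGlue (⟪v, γ.curve t⟫ - c) * ⟪v, γ.deriv t⟫ ^ 2 := by
    filter_upwards [hη'] with t ht
    rw [ht, real_inner_smul_right, real_inner_comm v (γ.deriv t)]
    ring
  -- The pairing integrates to zero and its integrand ψ' ⟪v, γ'⟫² is nonnegative. So almost
  -- everywhere ψ' or ⟪v, γ'⟫ vanishes, and either kills the derivative of η.
  have hderiv : ∀ᵐ t : I, η.deriv t = 0 := by
    rw [L2.inner_def] at horth
    have h1 : ∀ᵐ t : I, ⟪γ.deriv t, η.deriv t⟫ = 0 := by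
      refine (integral_eq_zero_iff_of_nonneg_ae ?_ (L2.integrable_inner _ _)).1 horth
      filter_upwards [hpt] with t ht
      rw [Pi.zero_apply, ht]
      exact mul_nonneg expNegInvGlue.monotone.deriv_nonneg (sq_nonneg _)
    filter_upwards [h1, hpt, hη'] with t h1 h2 h3
    rw [h3]
    rw [h2] at h1
    rcases mul_eq_zero.1 h1 with h | h
    · simp [h]
    · simp [pow_eq_zero_iff two_ne_zero |>.1 h]
  have hconst (t : I) : η.curve t = η.curve 0 := by
    rw [η.curve_eq t, integral_eq_zero_of_ae (ae_restrict_of_ae hderiv), add_zero]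
  have h1 : η.curve t₀ = 0 := by rw [hconst, ← hconst t₁, hzero t₁ ht₁]
  rw [hη] at h1
  rw [hlv] at hl
  -- Positivity of ψ beyond the hyperplane rules out the first case; v = 0 would contradict the
  -- strict separation.
  rcases smul_eq_zero.1 h1 with h | h
  · exact (expNegInvGlue.pos_of_pos (by linarith)).ne' h
  · have := hlE _ ht₁
    rw [hlv, h, inner_zero_left] at this
    rw [h, inner_zero_left] at hl
    linarith

end Critical

/-! ### Convergence of descent sequences -/

section Convergence

variable {d : ℕ} {w : I → EuclideanSpace ℝ (Fin d) → ℝ}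
  {G : I → EuclideanSpace ℝ (Fin d) → EuclideanSpace ℝ (Fin d)} {a : I → ℝ}
  {E : Set (EuclideanSpace ℝ (Fin d))} {α β : ℝ}

theorem IsC11Integrand.exists_norm_descent_le (hw : IsC11Integrand w G a E) (hα : 0 < α)
    (hβ : 0 < β) (hE : Bornology.IsBounded E) {γ : ℕ → H1 d}
    (hγ : IsDescentSequence (functionalF w α β) γ) : ∃ R, ∀ n, ‖γ n‖ ≤ R := by
  obtain ⟨R, hR⟩ := hw.exists_norm_le hα hβ hE (neg_pos.2 hγ.1)
  exact ⟨R, fun n => hR _ (by linarith [hγ.le_initial n])⟩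

theorem IsC11Integrand.tendsto_derivF_descent (hw : IsC11Integrand w G a E) (hα : 0 < α)
    (hβ : 0 < β) (hE : Bornology.IsBounded E) {γ : ℕ → H1 d}
    (hγ : IsDescentSequence (functionalF w α β) γ) :
    Tendsto (fun n => ‖derivF w G α β (γ n)‖) atTop (𝓝 0) := by
  obtain ⟨R, hR⟩ := hw.exists_norm_descent_le hα hβ hE hγ
  have hfd := hw.fderiv_functionalF hα hβ
  have h := hγ.tendsto_gradient (hw.contDiff_functionalF hα hβ).differentiable_one
    (hw.neg_le_functionalF hα hβ) (R := R) (by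
      obtain ⟨K, hK0, -, hK⟩ := hw.bddLipOn_derivF hα hβ (R + 1)
      rw [hfd]
      exact ⟨K, hK0, hK⟩) hR
  have h1 := h.norm
  simp_rw [norm_gradient, hfd, norm_zero] at h1
  exact h1

theorem IsC11Integrand.exists_tendsto_descent (hw : IsC11Integrand w G a E) (hα : 0 < α)
    (hβ : 0 < β) (hE : Bornology.IsBounded E) {γ : ℕ → H1 d}
    (hγ : IsDescentSequence (functionalF w α β) γ) :
    ∃ (γs : H1 d) (k : ℕ → ℕ), StrictMono k ∧ Tendsto (γ ∘ k) atTop (𝓝 γs) := by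
  obtain ⟨R, hR⟩ := hw.exists_norm_descent_le hα hβ hE hγ
  exact hw.exists_tendsto_subseq hα hβ (neg_pos.2 hγ.1)
    (fun n => by linarith [hγ.le_initial n]) hR (hw.tendsto_derivF_descent hα hβ hE hγ)

theorem IsC11Integrand.limit_descent (hw : IsC11Integrand w G a E) (hα : 0 < α)
    (hβ : 0 < β) (hEc : IsClosed E) (hconv : Convex ℝ E) (hE : Bornology.IsBounded E)
    {γ : ℕ → H1 d} (hγ : IsDescentSequence (functionalF w α β) γ) {γs : H1 d} {k : ℕ → ℕ}
    (hk : StrictMono k) (hlim : Tendsto (γ ∘ k) atTop (𝓝 γs)) :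
    functionalF w α β γs < 0 ∧ fderiv ℝ (functionalF w α β) γs = 0 ∧
      Set.range γs.curve ⊆ E := by
  have hC1 := hw.contDiff_functionalF (d := d) hα hβ
  -- The strict sign survives the limit because all values lie below the fixed negative number
  -- F(γ⁰).
  have hneg : functionalF w α β γs < 0 :=
    (le_of_tendsto ((hC1.continuous.tendsto γs).comp hlim)
      (Eventually.of_forall fun n => hγ.le_initial (k n))).trans_lt hγ.1
  have hcrit : fderiv ℝ (functionalF w α β) γs = 0 := by
    have h1 := (((hC1.continuous_fderiv one_ne_zero).tendsto γs).comp hlim).norm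
    have h2 := (hw.tendsto_derivF_descent hα hβ hE hγ).comp hk.tendsto_atTop
    rw [← hw.fderiv_functionalF hα hβ] at h2
    exact norm_eq_zero.1 (tendsto_nhds_unique h1 h2)
  refine ⟨hneg, hcrit, hw.range_curve_subset hα hβ hEc hconv hneg ?_⟩
  rw [← hcrit, hw.fderiv_functionalF hα hβ]

end Convergence

end DynamicInverse

end

/-! ### The main theorem -/

open DynamicInverse in
theorem mainTheorem5
    (d : ℕ) (hd : 1 ≤ d)
    (Ω : Set (EuclideanSpace ℝ (Fin d)))
    (hΩ_open : IsOpen Ω) (hΩ_conn : IsConnected Ω) (hΩ_bdd : Bornology.IsBounded Ω)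
    (D : Type*) [NormedAddCommGroup D] [NormedSpace ℝ D] [CompleteSpace D]
    (H : I → Type*) [∀ t, NormedAddCommGroup (H t)] [∀ t, InnerProductSpace ℝ (H t)]
    [∀ t, CompleteSpace (H t)]
    (i : ∀ t, D →L[ℝ] H t) (hi : SamplingAssumptions i)
    (E : Set (EuclideanSpace ℝ (Fin d)))
    (Kstar : ∀ t, StrongDual ℝ (C11 (closure Ω)) →L[ℝ] H t)
    (hK : ForwardAssumptions Ω E i Kstar)
    (ρ : I → SignedMeasure (closure Ω)) (hρ : NarrowlyContinuous ρ)
    (f : ∀ t, H t) (hf : MemL2H i f)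
    (α β : ℝ) (hα : 0 < α) (hβ : 0 < β) :
    (∀ γ : H1 d, Integrable fun t : I => dualVariable Kstar ρ f t (γ.curve t)) ∧
    ContDiff ℝ 1 (functionalF (d := d) (dualVariable Kstar ρ f) α β) ∧
    ∀ γ : ℕ → H1 d, IsDescentSequence (functionalF (dualVariable Kstar ρ f) α β) γ →
      (∃ (γs : H1 d) (k : ℕ → ℕ), StrictMono k ∧ Tendsto (γ ∘ k) atTop (𝓝 γs)) ∧
      ∀ γs : H1 d, (∃ k : ℕ → ℕ, StrictMono k ∧ Tendsto (γ ∘ k) atTop (𝓝 γs)) →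
        functionalF (dualVariable Kstar ρ f) α β γs < 0 ∧
        fderiv ℝ (functionalF (dualVariable Kstar ρ f) α β) γs = 0 ∧
        Set.range γs.curve ⊆ E := by
  have : CompactSpace (closure Ω) := isCompact_iff_compactSpace.1 hΩ_bdd.isCompact_closure
  obtain ⟨a, hw⟩ := exists_isC11Integrand hΩ_open hi hK hρ hf
  have hE_bdd : Bornology.IsBounded E := hK.compactly_contained.1.isBounded.subset subset_closure
  refine ⟨fun γ => hw.integrable_comp γ.curve, hw.contDiff_functionalF hα hβ, fun γ hγ => ?_⟩
  exact ⟨hw.exists_tendsto_descent hα hβ hE_bdd hγ, fun γs ⟨k, hk, hlim⟩ =>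
    hw.limit_descent hα hβ hK.isClosed hK.convex hE_bdd hγ hk hlim⟩
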